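/- **Setting.** A deterministic contextual MDP (DCMDP) consists of a horizon $H\ge 1$, a state space $\mathcal S$ partitioned into layers $\mathcal S_1,\dots,\mathcal S_H$, an action space $\mathcal A$, an initial distribution $\rho$ supported on $\mathcal S_1$, a deterministic transition map sending $\mathcal S_h\times\mathcal A$ into $\mathcal S_{h+1}$ for $h<H$, and a reward $r:\mathcal S\times\mathcal A\to\mathbb R$; all distributions are discrete. A policy is a map $\pi:\mathcal S\to\Delta(\mathcal A)$. It generates a trajectory $\tau=(s_1,a_1),\dots,(s_H,a_H)$ by $s_1\sim\rho$, $a_h\sim\pi(\cdot\mid s_h)$, with $s_{h+1}$ the successor of $(s_h,a_h)$; $d^\pi$ denotes the law of $\tau$. A trajectory is admissible if $\rho(s_1)>0$ and its states follow the transition map. Put $r(\tau)=\sum_h r(s_h,a_h)$ and $\pi(\tau)=\prod_h\pi(a_h\mid s_h)$. Assume $r(\tau)\in[0,R_{\max}]$ for all admissible $\tau$, where $R_{\max}>0$. Fix a reference policy $\pi_{\mathrm{ref}}$ and $\beta>0$, and let $$J_\beta(\pi)=\mathbb E_{\tau\sim d^\pi}\Big[r(\tau)-\beta\log\frac{\pi(\tau)}{\pi_{\mathrm{ref}}(\tau)}\Big]$$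 (equal to $-\infty$ if the KL divergence is infinite). Let $\pi^\star_\beta$ be a maximizer of $J_\beta$ over all policies. For a finite policy class $\Pi$ let $$C_{\mathsf{cov}}(\Pi)=\inf_{\mu\in\Delta((\mathcal S\times\mathcal A)^H)}\ \sup_{\tau\in(\mathcal S\times\mathcal A)^H}\ \sup_{\pi\in\Pi}\frac{d^\pi(\tau)}{\mu(\tau)} .$$ **Algorithm (XPO)** with parameters $T,\beta,\alpha$. Start with $\pi^{(1)}=\pi_{\mathrm{ref}}$. For $t=1,\dots,T$: draw $s_1^{(t)}\sim\rho$ and, independently given $s_1^{(t)}$, trajectories $\tau^{(t)}\sim\pi^{(t)}\mid s_1^{(t)}$ and $\tilde\tau^{(t)}\sim\pi_{\mathrm{ref}}\mid s_1^{(t)}$. Label them $(\tau_+^{(t)},\tau_-^{(t)})$ by a Bradley–Terry preference: $\tau^{(t)}$ is the preferred one with probability $e^{r(\tau^{(t)})}/(e^{r(\tau^{(t)})}+e^{r(\tilde\tau^{(t)})})$. Let $\pi^{(t+1)}$ be a minimizer over $\pi\in\Pi$ (ties broken arbitrarily) of $$\alpha\sum_{i=1}^t\log\pi(\tilde\tau^{(i)})-\sum_{i=1}^t\log\sigma\Big(\beta\log\frac{\pi(\tau_+^{(i)})}{\pi_{\mathrm{ref}}(\tau_+^{(i)})}-\beta\log\frac{\pi(\tau_-^{(i)})}{\pi_{\mathrm{ref}}(\tau_-^{(i)})}\Big),\qquad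 \sigma(x)=\frac{e^x}{1+e^x}.$$ The output $\hat\pi$ is a policy with the largest value of $J_\beta$ among $\pi^{(1)},\dots,\pi^{(T+1)}$. **Theorem.** For every $c>0$ there is a constant $C>0$, depending only on $c$, such that the following holds for every DCMDP, $\pi_{\mathrm{ref}}$, finite class $\Pi$, $\beta>0$, integer $T\ge2$ and $\delta\in(0,1)$. Suppose that $\pi^\star_\beta\in\Pi$, and that for all $\pi\in\Pi$ and all admissible $\tau$, $\big|\log\frac{\pi(\tau)}{\pi_{\mathrm{ref}}(\tau)}\big|\le\frac{V_{\max}}{\beta}$ (in particular $\pi(\tau)=0$ if and only if $\pi_{\mathrm{ref}}(\tau)=0$, in which case the bound is not required). Suppose $V_{\max}+R_{\max}\ge1$. If $$\alpha=c\cdot\frac{\beta}{(V_{\max}+R_{\max})e^{2R_{\max}}}\sqrt{\frac{\log(|\Pi|T\delta^{-1})}{T\,C_{\mathsf{cov}}(\Pi)}},$$ then with probability at least $1-\delta$ the output of XPO satisfies $$J_\beta(\pi^\star_\beta)-J_\beta(\hat\pi)\le C\,(V_{\max}+R_{\max})e^{2R_{\max}}\sqrt{\frac{C_{\mathsf{cov}}(\Pi)\log(|\Pi|T\delta^{-1})\log^2T}{T}}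 .$$ -/

import Mathlib

open scoped ENNReal

noncomputable section

namespace XPO

/-- A deterministic contextual MDP with horizon `H`, state space `S`, action space `A`, initial
state distribution `ρ`, deterministic transitions `next` and reward `r`. The state space is layered:
`layer s` is the (zero-based) step at which the state `s` can occur. The successor of a state of the
last layer plays no role. -/
structure DCMDP (S A : Type*) where
  H : ℕ
  H_pos : 0 < H
  layer : S → Fin H
  ρ : PMF S
  next : S → A → S
  r : S → A → ℝ
  layer_init : ∀ s ∈ ρ.support, (layer s : ℕ) = 0
  layer_next : ∀ s a, (layer s : ℕ) + 1 < H → (layer (next s a) : ℕ) = layer s + 1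

/-- A randomized policy; since the state space is layered it may depend on the time step. -/
abbrev Policy (S A : Type*) := S → PMF A

/-- The law of the next `n` state-action pairs when a policy is run from a state. -/
def rollout {S A : Type*} (next : S → A → S) (π : Policy S A) :
    (n : ℕ) → S → PMF (Fin n → S × A)
  | 0, _ => PMF.pure Fin.elim0
  | n + 1, s => (π s).bind fun a =>
      (rollout next π n (next s a)).map fun τ => Fin.cons (s, a) τ

namespace DCMDP

variable {S A : Type*} (M : DCMDP S A)

/-- Trajectories `(s₁, a₁), …, (s_H, a_H)`. -/
abbrev Traj := Fin M.H → S × A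

/-- Trajectories that can be generated by executing some policy. -/
def Admissible (τ : M.Traj) : Prop :=
  (τ ⟨0, M.H_pos⟩).1 ∈ M.ρ.support ∧
    ∀ (h : ℕ) (hh : h + 1 < M.H),
      (τ ⟨h + 1, hh⟩).1 = M.next (τ ⟨h, Nat.lt_of_succ_lt hh⟩).1 (τ ⟨h, Nat.lt_of_succ_lt hh⟩).2

/-- `r(τ)`. -/
def reward (τ : M.Traj) : ℝ := ∑ h, M.r (τ h).1 (τ h).2

/-- `π(τ) = ∏ₕ π(aₕ | sₕ)`. -/
def prob (π : Policy S A) (τ : M.Traj) : ℝ := ∏ h, (π (τ h).1 (τ h).2).toReal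

/-- The law of a trajectory of `π` given the initial state. -/
def trajLawFrom (π : Policy S A) (s : S) : PMF M.Traj := rollout M.next π M.H s

/-- The trajectory distribution `d^π`. -/
def trajLaw (π : Policy S A) : PMF M.Traj := M.ρ.bind fun s => M.trajLawFrom π s

/-- `log (π(τ) / π_ref(τ))`. -/
def logRatio (πref π : Policy S A) (τ : M.Traj) : ℝ := Real.log (M.prob π τ / M.prob πref τ)

open Classical in
/-- The KL-regularized objective `E_π[r(τ) - β log (π(τ) / π_ref(τ))]`, with value `-∞` if the
KL-divergence is infinite, that is, if `π` puts mass on trajectories with `π_ref(τ) = 0` or if the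
log-ratio is not integrable under `π`. -/
def J (πref : Policy S A) (β : ℝ) (π : Policy S A) : EReal :=
  if (∀ τ ∈ (M.trajLaw π).support, M.prob πref τ ≠ 0) ∧
      Summable (fun τ => (M.trajLaw π τ).toReal * M.logRatio πref π τ) then
    ((∑' τ, (M.trajLaw π τ).toReal * (M.reward τ - β * M.logRatio πref π τ) : ℝ) : EReal)
  else ⊥

/-- `πstar` maximizes the KL-regularized objective over all policies. -/
def IsOptimal (πref : Policy S A) (β : ℝ) (πstar : Policy S A) : Prop :=
  ∀ π : Policy S A, M.J πref β π ≤ M.J πref β πstar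

/-- Bounded density ratios: `|log (π(τ) / π_ref(τ))| ≤ Vmax / β` for all `π ∈ Π` and all
trajectories. The ratio is not allowed to be `0` or `∞`. -/
def BoundedRatios (πref : Policy S A) (β Vmax : ℝ) (Pi : Finset (Policy S A)) : Prop :=
  ∀ π ∈ Pi, ∀ τ : M.Traj, M.Admissible τ →
    (M.prob π τ = 0 ↔ M.prob πref τ = 0) ∧ |M.logRatio πref π τ| ≤ Vmax / β

/-- The trajectory-level coverability coefficient. -/
def coverability (Pi : Finset (Policy S A)) : ℝ≥0∞ :=
  ⨅ μ : PMF M.Traj, ⨆ τ : M.Traj, ⨆ π ∈ Pi, M.trajLaw π τ / μ τ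

/-- The Bradley-Terry preference: the law of the label that is `true` if `τ` is preferred over
`τ'`. -/
def bradleyTerry (τ τ' : M.Traj) : PMF Bool :=
  PMF.ofFintype
    (fun y => ENNReal.ofReal
      (Real.exp (M.reward (if y then τ else τ')) /
        (Real.exp (M.reward τ) + Real.exp (M.reward τ'))))
    (by
      rw [Fintype.sum_bool, ← ENNReal.ofReal_add (by positivity) (by positivity), ← add_div]
      simp only [if_true, Bool.false_eq_true, if_false]
      rw [div_self (by positivity), ENNReal.ofReal_one])

/-- The data of one round: the response `τ` of the current policy, the response `τ'` of the
reference policy, and the label, which is `true` if `τ` is preferred. -/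
structure Sample where
  τ : M.Traj
  τ' : M.Traj
  y : Bool

variable {M}

/-- The preferred response `τ₊`. -/
def Sample.pos (z : M.Sample) : M.Traj := if z.y then z.τ else z.τ'

/-- The other response `τ₋`. -/
def Sample.neg (z : M.Sample) : M.Traj := if z.y then z.τ' else z.τ

variable (M)

/-- The law of one round of data collection with current policy `π`: a common initial state, one
response of `π`, one response of `π_ref`, and a Bradley-Terry label. -/
def roundLaw (πref π : Policy S A) : PMF M.Sample :=
  M.ρ.bind fun s => (M.trajLawFrom π s).bind fun τ => (M.trajLawFrom πref s).bind fun τ' =>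
    (M.bradleyTerry τ τ').map fun y => ⟨τ, τ', y⟩

/-- The optimistic DPO objective for the data `D`. -/
def objective (πref : Policy S A) (β α : ℝ) (D : List M.Sample) (π : Policy S A) : ℝ :=
  α * (D.map fun z => Real.log (M.prob π z.τ')).sum -
    (D.map fun z => Real.log (Real.sigmoid
      (β * M.logRatio πref π z.pos - β * M.logRatio πref π z.neg))).sum

/-- `upd` is an update rule of the algorithm: after each round it picks, from the data so far, a
minimizer of the objective over the policy class. Ties are broken arbitrarily. -/
def IsUpdate (πref : Policy S A) (β α : ℝ) (Pi : Finset (Policy S A))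
    (upd : List M.Sample → Policy S A) : Prop :=
  ∀ D : List M.Sample, D ≠ [] → upd D ∈ Pi ∧
    ∀ π ∈ Pi, M.objective πref β α D (upd D) ≤ M.objective πref β α D π

variable {M}

/-- The policy that is played once the data `D` has been collected: `π_ref` in the first round, the
updated policy afterwards. -/
def current (πref : Policy S A) (upd : List M.Sample → Policy S A) :
    List M.Sample → Policy S A
  | [] => πref
  | z :: D => upd (z :: D)

/-- The law of the data (in chronological order) collected in the first `t` rounds. -/
def dataLaw (πref : Policy S A) (upd : List M.Sample → Policy S A) : ℕ → PMF (List M.Sample)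
  | 0 => PMF.pure []
  | t + 1 => (dataLaw πref upd t).bind fun D =>
      (M.roundLaw πref (current πref upd D)).map fun z => D ++ [z]

/-- `πhat` is an output of the algorithm after `T` rounds with data `D`: a policy with the largest
value of the objective `J` among the iterates, where iterate `t + 1` is computed from the first `t`
samples, `t = 0, …, T`. -/
def IsOutput (πref : Policy S A) (β : ℝ) (upd : List M.Sample → Policy S A) (T : ℕ)
    (D : List M.Sample) (πhat : Policy S A) : Prop :=
  (∃ t ≤ T, πhat = current πref upd (D.take t)) ∧
    ∀ t ≤ T, M.J πref β (current πref upd (D.take t)) ≤ M.J πref β πhat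

end DCMDP

end XPO

end

/-!
The policy `πstar` is the Gibbs reweighting of `πref` by `exp (r / β)`, so `β log (πstar / πref)`
equals the reward up to a function of the initial state, and the preference model of `πstar` is the
true Bradley-Terry model. Hence the regret of a policy `π` is the error of its implicit reward
difference on pairs drawn from `π` and `πref`, plus `β` times the expected log-ratio of `π` and
`πstar` under `πref`, which is what the optimism term of the objective penalizes.

Half of the log-likelihood ratio is an exponential supermartingale once it is compensated by the
squared Hellinger distances of the preference models, and a union bound over policies and rounds
makes the corresponding bound uniform. For an iterate, which beats `πstar` in the objective, this
controls the sum over the past rounds of those distances together with the optimism term. The past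
distances control the error under the iterate itself up to its novelty relative to the past, and
under coverability the novelty summed over the rounds is logarithmic in `T`. Some round is at least
as good as the average.
-/

noncomputable section

namespace XPO

/-! ### Expectations under discrete distributions -/

section Expectation

variable {X Y : Type*}

/-- The expectation of a real-valued function under a discrete distribution; it is the junk value
`0` if the defining series does not converge absolutely, see `Integrable`. -/
def expect (p : PMF X) (f : X → ℝ) : ℝ := ∑' x, (p x).toReal * f x

/-- The expectation of an extended nonnegative function, which needs no integrability. -/
def lexpect (p : PMF X) (f : X → ℝ≥0∞) : ℝ≥0∞ := ∑' x, p x * f x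

/-- The function `f` has a well-defined expectation `expect p f`. -/
def Integrable (p : PMF X) (f : X → ℝ) : Prop := Summable fun x => (p x).toReal * f x

lemma lexpect_congr {p : PMF X} {f g : X → ℝ≥0∞} (h : ∀ x ∈ p.support, f x = g x) :
    lexpect p f = lexpect p g := by
  refine tsum_congr fun x => ?_
  by_cases hx : p x = 0
  · rw [hx, zero_mul, zero_mul]
  · rw [h x hx]

lemma lexpect_mono {p : PMF X} {f g : X → ℝ≥0∞} (h : ∀ x ∈ p.support, f x ≤ g x) :
    lexpect p f ≤ lexpect p g := by
  refine ENNReal.tsum_le_tsum fun x => ?_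
  by_cases hx : p x = 0
  · rw [hx, zero_mul, zero_mul]
  · exact mul_le_mul_right (h x hx) _

lemma lexpect_add (p : PMF X) (f g : X → ℝ≥0∞) :
    lexpect p (fun x => f x + g x) = lexpect p f + lexpect p g := by
  simp only [lexpect, mul_add, ENNReal.tsum_add]

lemma lexpect_const (p : PMF X) (c : ℝ≥0∞) : lexpect p (fun _ => c) = c := by
  rw [lexpect, ENNReal.tsum_mul_right, p.tsum_coe, one_mul]

lemma lexpect_const_mul (p : PMF X) (c : ℝ≥0∞) (f : X → ℝ≥0∞) :
    lexpect p (fun x => c * f x) = c * lexpect p f := by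
  simp only [lexpect, mul_left_comm _ c, ENNReal.tsum_mul_left]

lemma lexpect_pure (a : X) (f : X → ℝ≥0∞) : lexpect (PMF.pure a) f = f a := by
  rw [lexpect, tsum_eq_single a fun b hb => by rw [PMF.pure_apply_of_ne _ _ hb, zero_mul],
    PMF.pure_apply_self, one_mul]

lemma lexpect_bind (p : PMF X) (k : X → PMF Y) (f : Y → ℝ≥0∞) :
    lexpect (p.bind k) f = lexpect p fun a => lexpect (k a) f := by
  simp only [lexpect, PMF.bind_apply, ← ENNReal.tsum_mul_right, ← ENNReal.tsum_mul_left,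
    ← mul_assoc]
  exact ENNReal.tsum_comm

lemma lexpect_map (p : PMF X) (k : X → Y) (f : Y → ℝ≥0∞) :
    lexpect (p.map k) f = lexpect p fun x => f (k x) := by
  simp only [← PMF.bind_pure_comp, lexpect_bind, Function.comp_apply, lexpect_pure]

lemma toOuterMeasure_eq_lexpect (p : PMF X) (s : Set X) :
    p.toOuterMeasure s = lexpect p (s.indicator 1) := by
  rw [PMF.toOuterMeasure_apply]
  refine tsum_congr fun x => ?_
  by_cases hx : x ∈ s <;> simp [hx]

lemma summable_toReal (p : PMF X) : Summable fun x => (p x).toReal :=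
  ENNReal.summable_toReal p.tsum_coe_ne_top

lemma tsum_toReal (p : PMF X) : ∑' x, (p x).toReal = 1 := by
  rw [← ENNReal.tsum_toReal_eq p.apply_ne_top, p.tsum_coe, ENNReal.toReal_one]

lemma toReal_mul_le_toReal_mul {p : PMF X} {f g : X → ℝ} (h : ∀ x ∈ p.support, f x ≤ g x) (x : X) :
    (p x).toReal * f x ≤ (p x).toReal * g x := by
  by_cases hx : p x = 0
  · simp [hx]
  · exact mul_le_mul_of_nonneg_left (h x hx) ENNReal.toReal_nonneg

lemma integrable_const (p : PMF X) (c : ℝ) : Integrable p fun _ => c :=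
  (summable_toReal p).mul_right c

lemma Integrable.congr {p : PMF X} {f g : X → ℝ} (hf : Integrable p f)
    (h : ∀ x ∈ p.support, f x = g x) : Integrable p g :=
  Summable.congr hf fun x => by
    by_cases hx : p x = 0
    · simp [hx]
    · rw [h x hx]

lemma Integrable.sub {p : PMF X} {f g : X → ℝ} (hf : Integrable p f) (hg : Integrable p g) :
    Integrable p fun x => f x - g x := by
  simpa only [Integrable, mul_sub] using Summable.sub hf hg

lemma Integrable.const_mul {p : PMF X} {f : X → ℝ} (hf : Integrable p f) (c : ℝ) :
    Integrable p fun x => c * f x := by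
  simpa only [Integrable, mul_left_comm _ c] using Summable.mul_left c hf

lemma integrable_of_abs_le {p : PMF X} {f : X → ℝ} {B : ℝ} (h : ∀ x ∈ p.support, |f x| ≤ B) :
    Integrable p f :=
  Summable.of_norm_bounded (integrable_const p B) fun x => by
    rw [norm_mul, Real.norm_of_nonneg ENNReal.toReal_nonneg, Real.norm_eq_abs]
    exact toReal_mul_le_toReal_mul h x

lemma expect_congr {p : PMF X} {f g : X → ℝ} (h : ∀ x ∈ p.support, f x = g x) :
    expect p f = expect p g := by
  refine tsum_congr fun x => ?_
  by_cases hx : p x = 0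
  · simp [hx]
  · rw [h x hx]

lemma expect_const (p : PMF X) (c : ℝ) : expect p (fun _ => c) = c := by
  rw [expect, tsum_mul_right, tsum_toReal, one_mul]

lemma expect_sub {p : PMF X} {f g : X → ℝ} (hf : Integrable p f) (hg : Integrable p g) :
    expect p (fun x => f x - g x) = expect p f - expect p g := by
  simpa only [expect, mul_sub] using Summable.tsum_sub hf hg

lemma expect_const_mul (p : PMF X) (c : ℝ) (f : X → ℝ) :
    expect p (fun x => c * f x) = c * expect p f := by
  simp only [expect, mul_left_comm _ c, tsum_mul_left]

lemma expect_mono {p : PMF X} {f g : X → ℝ} (hf : Integrable p f) (hg : Integrable p g)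
    (h : ∀ x ∈ p.support, f x ≤ g x) : expect p f ≤ expect p g :=
  Summable.tsum_le_tsum (toReal_mul_le_toReal_mul h) hf hg

lemma expect_nonneg {p : PMF X} {f : X → ℝ} (h : ∀ x ∈ p.support, 0 ≤ f x) : 0 ≤ expect p f :=
  tsum_nonneg fun x => by simpa using toReal_mul_le_toReal_mul h x

lemma abs_expect_le {p : PMF X} {f : X → ℝ} {B : ℝ} (hf : ∀ x ∈ p.support, |f x| ≤ B) :
    |expect p f| ≤ B := by
  have hint := integrable_of_abs_le hf
  refine abs_le.2 ⟨?_, ?_⟩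
  · rw [← expect_const p (-B)]
    exact expect_mono (integrable_const p _) hint fun x hx => (abs_le.1 (hf x hx)).1
  · rw [← expect_const p B]
    exact expect_mono hint (integrable_const p _) fun x hx => (abs_le.1 (hf x hx)).2

lemma ofReal_expect {p : PMF X} {f : X → ℝ} (hf : Integrable p f)
    (h0 : ∀ x ∈ p.support, 0 ≤ f x) :
    ENNReal.ofReal (expect p f) = lexpect p fun x => ENNReal.ofReal (f x) := by
  rw [expect, ENNReal.ofReal_tsum_of_nonneg
    (fun x => by simpa using toReal_mul_le_toReal_mul h0 x) hf]
  refine tsum_congr fun x => ?_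
  rw [ENNReal.ofReal_mul ENNReal.toReal_nonneg, ENNReal.ofReal_toReal (p.apply_ne_top x)]

lemma integrable_iff_lexpect_enorm_ne_top {p : PMF X} {f : X → ℝ} :
    Integrable p f ↔ lexpect p (fun x => ‖f x‖ₑ) ≠ ⊤ := by
  have hterm : ∀ x, ‖(p x).toReal * f x‖ = (p x * ‖f x‖ₑ).toReal := fun x => by
    rw [norm_mul, ENNReal.toReal_mul, toReal_enorm, Real.norm_of_nonneg ENNReal.toReal_nonneg]
  rw [Integrable, ← summable_norm_iff, summable_congr hterm]
  refine ⟨fun h => ?_, ENNReal.summable_toReal⟩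
  rw [lexpect, ← tsum_congr fun x =>
    ENNReal.ofReal_toReal (ENNReal.mul_ne_top (p.apply_ne_top x) (enorm_ne_top (x := f x)))]
  exact h.tsum_ofReal_ne_top

lemma integrable_bind_iff {p : PMF X} {k : X → PMF Y} {f : Y → ℝ} :
    Integrable (p.bind k) f ↔ lexpect p (fun a => lexpect (k a) fun y => ‖f y‖ₑ) ≠ ⊤ := by
  rw [integrable_iff_lexpect_enorm_ne_top, lexpect_bind]

lemma integrable_map_iff {p : PMF X} {k : X → Y} {f : Y → ℝ} :
    Integrable (p.map k) f ↔ Integrable p fun x => f (k x) := by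
  simp only [integrable_iff_lexpect_enorm_ne_top, lexpect_map]

lemma expect_pure (a : X) (f : X → ℝ) : expect (PMF.pure a) f = f a := by
  rw [expect, tsum_eq_single a fun b hb => by simp [PMF.pure_apply_of_ne _ _ hb],
    PMF.pure_apply_self, ENNReal.toReal_one, one_mul]

lemma expect_bind {p : PMF X} {k : X → PMF Y} {f : Y → ℝ} (hf : Integrable (p.bind k) f) :
    expect (p.bind k) f = expect p fun a => expect (k a) f := by
  have hjoint : Summable (Function.uncurry fun a y => (p a).toReal * ((k a y).toReal * f y)) := by
    have hfin : ∑' z : X × Y, p z.1 * (k z.1 z.2 * ‖f z.2‖ₑ) ≠ ⊤ := by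
      rw [ENNReal.tsum_prod']
      simpa only [lexpect, ENNReal.tsum_mul_left] using integrable_bind_iff.1 hf
    refine Summable.of_norm ((ENNReal.summable_toReal hfin).congr fun z => ?_)
    simp [Function.uncurry]
  calc expect (p.bind k) f
      = ∑' y, ∑' a, (p a).toReal * ((k a y).toReal * f y) := by
        refine tsum_congr fun y => ?_
        rw [PMF.bind_apply, ENNReal.tsum_toReal_eq fun a =>
          ENNReal.mul_ne_top (p.apply_ne_top a) ((k a).apply_ne_top y), ← tsum_mul_right]
        exact tsum_congr fun a => by rw [ENNReal.toReal_mul, mul_assoc]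
    _ = ∑' a, ∑' y, (p a).toReal * ((k a y).toReal * f y) := hjoint.tsum_comm
    _ = expect p fun a => expect (k a) f := by simp only [expect, tsum_mul_left]

lemma expect_map {p : PMF X} {k : X → Y} {f : Y → ℝ} (hf : Integrable p fun x => f (k x)) :
    expect (p.map k) f = expect p fun x => f (k x) := by
  have hint : Integrable (p.bind (PMF.pure ∘ k)) f := by
    rwa [PMF.bind_pure_comp, integrable_map_iff]
  rw [← PMF.bind_pure_comp, expect_bind hint]
  simp only [Function.comp_apply, expect_pure]

/-- **Hoeffding's lemma**. -/
lemma lexpect_exp_mul_sub_expect_le {p : PMF X} {f : X → ℝ} {a b : ℝ}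
    (hf : ∀ x ∈ p.support, f x ∈ Set.Icc a b) (l : ℝ) :
    lexpect p (fun x => ENNReal.ofReal (Real.exp (l * (f x - expect p f)))) ≤
      ENNReal.ofReal (Real.exp ((b - a) ^ 2 * l ^ 2 / 8)) := by
  let _ : MeasurableSpace X := ⊤
  have : MeasurableSingletonClass X := ⟨fun _ => trivial⟩
  have hm : AEMeasurable f p.toMeasure := Measurable.aemeasurable fun _ _ => trivial
  have hae : ∀ᵐ x ∂p.toMeasure, f x ∈ Set.Icc a b := by
    rw [MeasureTheory.ae_iff, PMF.toMeasure_apply_eq_zero_iff p trivial, Set.disjoint_left]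
    exact fun x hx hx' => hx' (hf x hx)
  have hexpect : ∫ x, f x ∂p.toMeasure = expect p f :=
    PMF.integral_eq_tsum p f (MeasureTheory.Integrable.of_mem_Icc _ _ hm hae)
  have hsub := ProbabilityTheory.hasSubgaussianMGF_of_mem_Icc hm hae
  rw [hexpect] at hsub
  have hint := hsub.integrable_exp_mul l
  have hmgf := hsub.mgf_le l
  rw [ProbabilityTheory.mgf, PMF.integral_eq_tsum p _ hint] at hmgf
  have habs : ∀ x ∈ p.support, |f x| ≤ max |a| |b| := fun x hx =>
    abs_le_max_abs_abs (hf x hx).1 (hf x hx).2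
  have hbound : ∀ x ∈ p.support,
      |Real.exp (l * (f x - expect p f))| ≤ Real.exp (|l| * (max |a| |b| + max |a| |b|)) := by
    intro x hx
    rw [Real.abs_exp, Real.exp_le_exp]
    refine (le_abs_self _).trans ((abs_mul _ _).trans_le ?_)
    gcongr
    exact (abs_sub _ _).trans (add_le_add (habs x hx) (abs_expect_le habs))
  rw [← ofReal_expect (integrable_of_abs_le hbound) fun x _ => (Real.exp_pos _).le]
  refine ENNReal.ofReal_le_ofReal (hmgf.trans_eq (congrArg Real.exp ?_))
  push_cast
  rw [div_pow, Real.norm_eq_abs, sq_abs]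
  ring

/-- **Gibbs' inequality**, in the form of its equality case. -/
lemma eq_of_expect_log_div_nonpos {p q : PMF X} (hpq : p.support ⊆ q.support)
    (hint : Integrable p fun x => Real.log ((p x).toReal / (q x).toReal))
    (h : expect p (fun x => Real.log ((p x).toReal / (q x).toReal)) ≤ 0) : p = q := by
  set F : X → ℝ := fun x => (q x).toReal * InformationTheory.klFun ((p x).toReal / (q x).toReal)
  have hF : F = fun x => (p x).toReal * Real.log ((p x).toReal / (q x).toReal) +
      ((q x).toReal - (p x).toReal) := by
    funext x
    by_cases hq : q x = 0
    · have hp : p x = 0 := by_contra fun hp => hpq hp hq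
      simp [F, hp, hq]
    · have hq' : (q x).toReal ≠ 0 := ENNReal.toReal_ne_zero.2 ⟨hq, q.apply_ne_top x⟩
      simp only [F, InformationTheory.klFun_apply]
      field_simp
      ring
  have hratio : ∀ x, 0 ≤ (p x).toReal / (q x).toReal := fun x =>
    div_nonneg ENNReal.toReal_nonneg ENNReal.toReal_nonneg
  have hF0 : ∀ x, 0 ≤ F x := fun x =>
    mul_nonneg ENNReal.toReal_nonneg (InformationTheory.klFun_nonneg (hratio x))
  have hdiff := (summable_toReal q).sub (summable_toReal p)
  have hFsum : HasSum F 0 := by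
    have hs : Summable F := hF ▸ Summable.add hint hdiff
    have htsum : ∑' x, F x ≤ 0 := by
      rw [hF, Summable.tsum_add hint hdiff, (summable_toReal q).tsum_sub (summable_toReal p),
        tsum_toReal, tsum_toReal, sub_self, add_zero]
      exact h
    exact le_antisymm htsum (tsum_nonneg hF0) ▸ hs.hasSum
  ext x
  rcases mul_eq_zero.1 (congrFun ((hasSum_zero_iff_of_nonneg hF0).1 hFsum) x) with hq | hkl
  · have hq : q x = 0 := (ENNReal.toReal_eq_zero_iff _).1 hq |>.resolve_right (q.apply_ne_top x)
    rw [hq]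
    exact by_contra fun hp => hpq hp hq
  · rw [InformationTheory.klFun_eq_zero_iff (hratio x)] at hkl
    exact (ENNReal.toReal_eq_toReal_iff' (p.apply_ne_top x) (q.apply_ne_top x)).1
      (eq_of_div_eq_one hkl)

end Expectation

/-! ### Logistic function and Hellinger distance -/

section Logistic

lemma exp_neg_abs_le_sigmoid_mul (b : ℝ) :
    Real.exp (-|b|) / 4 ≤ Real.sigmoid b * Real.sigmoid (-b) := by
  wlog hb : 0 ≤ b generalizing b
  · have h := this (-b) (by linarith)
    rwa [abs_neg, neg_neg, mul_comm] at h
  have hhalf : (2 : ℝ)⁻¹ ≤ Real.sigmoid b := Real.sigmoid_zero ▸ Real.sigmoid_le hb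
  calc Real.exp (-|b|) / 4 = 2⁻¹ * 2⁻¹ * Real.exp (-b) := by rw [abs_of_nonneg hb]; ring
    _ ≤ Real.sigmoid b * Real.sigmoid b * Real.exp (-b) := by gcongr
    _ = Real.sigmoid b * Real.sigmoid (-b) := by rw [mul_assoc, Real.sigmoid_mul_rexp_neg]

lemma sigmoid_sub_sigmoid (a b : ℝ) :
    Real.sigmoid a - Real.sigmoid b =
      Real.sigmoid a * Real.sigmoid (-b) * (1 - Real.exp (-(a - b))) := by
  have hb := Real.sigmoid_mul_rexp_neg (-b)
  rw [neg_neg] at hb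
  calc Real.sigmoid a - Real.sigmoid b
      = Real.sigmoid a * Real.sigmoid (-b) - Real.sigmoid (-a) * Real.sigmoid b := by
        rw [Real.sigmoid_neg, Real.sigmoid_neg]; ring
    _ = Real.sigmoid a * Real.sigmoid (-b) * (1 - Real.exp (-a) * Real.exp b) := by
        rw [← Real.sigmoid_mul_rexp_neg a, ← hb]; ring
    _ = Real.sigmoid a * Real.sigmoid (-b) * (1 - Real.exp (-(a - b))) := by
        rw [← Real.exp_add, neg_add_eq_sub, neg_sub]

lemma le_one_add_mul_one_sub_exp_neg (u : ℝ) : u ≤ (1 + u) * (1 - Real.exp (-u)) := by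
  have h : (1 + u) * Real.exp (-u) ≤ 1 := by
    rw [Real.exp_neg, ← div_eq_mul_inv, div_le_one (Real.exp_pos u)]
    linarith [Real.add_one_le_exp u]
  linarith

lemma sub_le_mul_sigmoid_sub {a b : ℝ} (h : b ≤ a) :
    a - b ≤ 4 * Real.exp |b| * (1 + (a - b)) * (Real.sigmoid a - Real.sigmoid b) := by
  have hsub : 0 ≤ a - b := sub_nonneg.2 h
  have hexp : 0 ≤ 1 - Real.exp (-(a - b)) :=
    sub_nonneg.2 (Real.exp_le_one_iff.2 (neg_nonpos.2 hsub))
  have hslope : 1 ≤ 4 * Real.exp |b| * (Real.sigmoid a * Real.sigmoid (-b)) :=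
    calc (1 : ℝ) = 4 * Real.exp |b| * (Real.exp (-|b|) / 4) := by
          rw [Real.exp_neg]; field_simp
      _ ≤ 4 * Real.exp |b| * (Real.sigmoid b * Real.sigmoid (-b)) := by
          gcongr
          exact exp_neg_abs_le_sigmoid_mul b
      _ ≤ 4 * Real.exp |b| * (Real.sigmoid a * Real.sigmoid (-b)) := by
          gcongr
          exact Real.sigmoid_nonneg _
  calc a - b ≤ 1 * ((1 + (a - b)) * (1 - Real.exp (-(a - b)))) := by
        rw [one_mul]; exact le_one_add_mul_one_sub_exp_neg (a - b)
    _ ≤ 4 * Real.exp |b| * (Real.sigmoid a * Real.sigmoid (-b)) *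
          ((1 + (a - b)) * (1 - Real.exp (-(a - b)))) := by gcongr
    _ = 4 * Real.exp |b| * (1 + (a - b)) * (Real.sigmoid a - Real.sigmoid b) := by
        rw [sigmoid_sub_sigmoid]; ring

lemma abs_sub_le_mul_abs_sigmoid_sub (a b : ℝ) :
    |a - b| ≤ 4 * Real.exp |b| * (1 + |a - b|) * |Real.sigmoid a - Real.sigmoid b| := by
  wlog h : b ≤ a generalizing a b
  · have hneg := this (-a) (-b) (neg_le_neg (le_of_not_ge h))
    rw [abs_neg, Real.sigmoid_neg, Real.sigmoid_neg, sub_sub_sub_cancel_left,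
      neg_sub_neg] at hneg
    rwa [abs_sub_comm a b, abs_sub_comm (Real.sigmoid a)]
  rw [abs_of_nonneg (sub_nonneg.2 h), abs_of_nonneg (sub_nonneg.2 (Real.sigmoid_le h))]
  exact sub_le_mul_sigmoid_sub h

/-- The squared Hellinger distance between the Bernoulli distributions with logits `a` and `b`,
written through their Bhattacharyya coefficient. -/
def hellinger (a b : ℝ) : ℝ :=
  1 - (√(Real.sigmoid a * Real.sigmoid b) + √(Real.sigmoid (-a) * Real.sigmoid (-b)))

lemma sqrt_mul_le_half_add_sub_sq {p q : ℝ} (hp : 0 ≤ p) (hq : 0 ≤ q) (hp1 : p ≤ 1)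
    (hq1 : q ≤ 1) : √(p * q) ≤ (p + q) / 2 - (p - q) ^ 2 / 8 := by
  have hsum : (√p + √q) ^ 2 ≤ 4 := by
    have := add_le_add (Real.sqrt_le_one.2 hp1) (Real.sqrt_le_one.2 hq1)
    nlinarith [Real.sqrt_nonneg p, Real.sqrt_nonneg q]
  have hsq : (p - q) ^ 2 ≤ 4 * (√p - √q) ^ 2 :=
    calc (p - q) ^ 2 = (√p + √q) ^ 2 * (√p - √q) ^ 2 := by
          rw [← mul_pow, ← sq_sub_sq, Real.sq_sqrt hp, Real.sq_sqrt hq]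
      _ ≤ 4 * (√p - √q) ^ 2 := by gcongr
  have hexpand : (√p - √q) ^ 2 = p - 2 * (√p * √q) + q := by
    rw [sub_sq, Real.sq_sqrt hp, Real.sq_sqrt hq, mul_assoc]
  rw [hexpand] at hsq
  rw [Real.sqrt_mul hp]
  linarith

lemma sq_sigmoid_sub_le_hellinger (a b : ℝ) :
    (Real.sigmoid a - Real.sigmoid b) ^ 2 ≤ 4 * hellinger a b := by
  have hpos := sqrt_mul_le_half_add_sub_sq (Real.sigmoid_nonneg a) (Real.sigmoid_nonneg b)
    (Real.sigmoid_le_one a) (Real.sigmoid_le_one b)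
  have hneg := sqrt_mul_le_half_add_sub_sq (Real.sigmoid_nonneg (-a)) (Real.sigmoid_nonneg (-b))
    (Real.sigmoid_le_one (-a)) (Real.sigmoid_le_one (-b))
  have hsub : Real.sigmoid (-a) - Real.sigmoid (-b) = -(Real.sigmoid a - Real.sigmoid b) := by
    rw [Real.sigmoid_neg, Real.sigmoid_neg]; ring
  rw [hsub, neg_sq] at hneg
  rw [hellinger]
  linarith [Real.sigmoid_neg a, Real.sigmoid_neg b]

lemma hellinger_nonneg (a b : ℝ) : 0 ≤ hellinger a b := by
  linarith [sq_sigmoid_sub_le_hellinger a b, sq_nonneg (Real.sigmoid a - Real.sigmoid b)]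

lemma hellinger_le_one (a b : ℝ) : hellinger a b ≤ 1 :=
  sub_le_self 1 (add_nonneg (Real.sqrt_nonneg _) (Real.sqrt_nonneg _))

lemma sq_sub_le_hellinger {a b R D : ℝ} (hb : |b| ≤ R) (hab : |a - b| ≤ D) :
    (a - b) ^ 2 ≤ 64 * ((1 + D) * Real.exp R) ^ 2 * hellinger a b :=
  calc (a - b) ^ 2 = |a - b| ^ 2 := (sq_abs _).symm
    _ ≤ (4 * Real.exp |b| * (1 + |a - b|) * |Real.sigmoid a - Real.sigmoid b|) ^ 2 := by
        gcongr
        exact abs_sub_le_mul_abs_sigmoid_sub a b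
    _ ≤ (4 * Real.exp R * (1 + D) * |Real.sigmoid a - Real.sigmoid b|) ^ 2 := by gcongr
    _ = 16 * ((1 + D) * Real.exp R) ^ 2 * (Real.sigmoid a - Real.sigmoid b) ^ 2 := by
        rw [mul_pow, sq_abs]; ring
    _ ≤ 16 * ((1 + D) * Real.exp R) ^ 2 * (4 * hellinger a b) := by
        gcongr
        exact sq_sigmoid_sub_le_hellinger a b
    _ = 64 * ((1 + D) * Real.exp R) ^ 2 * hellinger a b := by ring

end Logistic

/-! ### Change of measure under coverage -/

section Coverage

lemma div_le_two_mul_log_add_sub_log {q w : ℝ} (hw : 0 < w) (hq : 0 ≤ q) (hqw : q ≤ w) :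
    q / w ≤ 2 * (Real.log (w + q) - Real.log w) :=
  calc q / w ≤ 2 * (q / (w + q)) := by
        rw [mul_div_assoc', div_le_div_iff₀ hw (by positivity)]
        nlinarith
    _ = 2 * (1 - ((w + q) / w)⁻¹) := by
        field_simp
        ring
    _ ≤ 2 * (Real.log (w + q) - Real.log w) := by
        rw [← Real.log_div (by positivity) hw.ne']
        gcongr
        exact Real.one_sub_inv_le_log_of_pos (by positivity)

lemma sum_mul_div_partialSum_le_log {q : ℕ → ℝ} {c : ℝ} (hq : ∀ i, 0 ≤ q i) (hqc : ∀ i, q i ≤ c)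
    (T : ℕ) :
    ∑ t ∈ Finset.range T, c * q t / (∑ i ∈ Finset.range t, q i + c) ≤
      c * (2 * Real.log (1 + T)) := by
  rcases ((hq 0).trans (hqc 0)).eq_or_lt with rfl | hc
  · simp
  set w : ℕ → ℝ := fun t => ∑ i ∈ Finset.range t, q i + c with hwdef
  have hcw : ∀ t, c ≤ w t := fun t => le_add_of_nonneg_left (Finset.sum_nonneg fun i _ => hq i)
  have hw : ∀ t, 0 < w t := fun t => hc.trans_le (hcw t)
  have hstep : ∀ t, q t / w t ≤ 2 * (Real.log (w (t + 1)) - Real.log (w t)) := fun t => by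
    have hsucc : w (t + 1) = w t + q t := by
      simp only [hwdef, Finset.sum_range_succ]; ring
    rw [hsucc]
    exact div_le_two_mul_log_add_sub_log (hw t) (hq t) ((hqc t).trans (hcw t))
  have hwT : w T / c ≤ 1 + T := by
    have : ∑ i ∈ Finset.range T, q i ≤ T * c := by
      simpa using Finset.sum_le_card_nsmul (Finset.range T) _ _ fun i _ => hqc i
    rw [div_le_iff₀ hc]
    linarith
  calc ∑ t ∈ Finset.range T, c * q t / w t = c * ∑ t ∈ Finset.range T, q t / w t := by
        simp only [mul_div_assoc, Finset.mul_sum]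
    _ ≤ c * ∑ t ∈ Finset.range T, 2 * (Real.log (w (t + 1)) - Real.log (w t)) := by
        gcongr with t
        exact hstep t
    _ = c * (2 * Real.log (w T / c)) := by
        rw [← Finset.mul_sum, Finset.sum_range_sub fun t => Real.log (w t),
          ← Real.log_div (hw T).ne' (hw 0).ne']
        simp [hwdef]
    _ ≤ c * (2 * Real.log (1 + T)) := by
        gcongr
        exact div_pos (hw T) hc

-- The two terms come from two regimes. If `d ≤ c` then `q` is at most twice the ratio
-- `c * q / (d + c)`; otherwise AM-GM splits `q * |g|`, and `q ^ 2 / (2 * d)` is below that ratio.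
lemma mul_abs_le_mul_ratio_add {c d q g G η : ℝ} (hq : 0 < q) (hqc : q ≤ c) (hd : 0 ≤ d)
    (hg : |g| ≤ G) (hη : 0 < η) :
    q * |g| ≤ (2 * G + 1 / η) * (c * q / (d + c)) + η / 2 * (d * g ^ 2) := by
  have hc : 0 < c := hq.trans_le hqc
  have hG : 0 ≤ G := (abs_nonneg g).trans hg
  rcases le_or_gt d c with hdc | hcd
  · have hratio : q ≤ 2 * (c * q / (d + c)) := by
      rw [mul_div_assoc', le_div_iff₀ (by positivity)]
      nlinarith
    calc q * |g| ≤ 2 * (c * q / (d + c)) * G := by gcongr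
      _ = 2 * G * (c * q / (d + c)) := by ring
      _ ≤ (2 * G + 1 / η) * (c * q / (d + c)) := by
          gcongr
          exact le_add_of_nonneg_right (by positivity)
      _ ≤ _ := le_add_of_nonneg_right (by positivity)
  · have hd' : 0 < d := hc.trans hcd
    have hratio : q ^ 2 / (2 * d) ≤ c * q / (d + c) :=
      calc q ^ 2 / (2 * d) ≤ c * q / (2 * d) := by
            rw [sq]
            gcongr
        _ ≤ c * q / (d + c) := by
            gcongr
            linarith
    have hamgm : q * |g| ≤ 1 / η * (q ^ 2 / (2 * d)) + η / 2 * (d * g ^ 2) := by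
      have hsquare : 1 / η * (q ^ 2 / (2 * d)) + η / 2 * (d * g ^ 2) - q * |g| =
          (q - η * d * |g|) ^ 2 / (2 * η * d) := by
        rw [← sq_abs g]
        field_simp
        ring
      exact sub_nonneg.1 (hsquare ▸ by positivity)
    calc q * |g| ≤ 1 / η * (q ^ 2 / (2 * d)) + η / 2 * (d * g ^ 2) := hamgm
      _ ≤ (2 * G + 1 / η) * (c * q / (d + c)) + η / 2 * (d * g ^ 2) := by
          gcongr
          exact le_add_of_nonneg_left (by positivity)

variable {X : Type*}

/-- How new the distribution `p t` is at `x` relative to `p 0, …, p (t - 1)`, regularized by `C`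
copies of the covering distribution `m`; the terms of an elliptic-potential argument. -/
def novelty (p : ℕ → PMF X) (m : PMF X) (C : ℝ) (t : ℕ) (x : X) : ℝ :=
  C * (m x).toReal * (p t x).toReal / (∑ i ∈ Finset.range t, (p i x).toReal + C * (m x).toReal)

variable {p : ℕ → PMF X} {m : PMF X} {C : ℝ} {t : ℕ}

lemma novelty_nonneg {x : X} (h : (p t x).toReal ≤ C * (m x).toReal) : 0 ≤ novelty p m C t x := by
  have hc := ENNReal.toReal_nonneg.trans h
  exact div_nonneg (mul_nonneg hc ENNReal.toReal_nonneg)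
    (add_nonneg (Finset.sum_nonneg fun _ _ => ENNReal.toReal_nonneg) hc)

lemma tsum_novelty_nonneg (h : ∀ x, (p t x).toReal ≤ C * (m x).toReal) :
    0 ≤ ∑' x, novelty p m C t x :=
  tsum_nonneg fun x => novelty_nonneg (h x)

lemma novelty_le {x : X} (h : (p t x).toReal ≤ C * (m x).toReal) :
    novelty p m C t x ≤ (p t x).toReal := by
  have hc := ENNReal.toReal_nonneg.trans h
  have hd : 0 ≤ ∑ i ∈ Finset.range t, (p i x).toReal :=
    Finset.sum_nonneg fun _ _ => ENNReal.toReal_nonneg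
  rw [novelty, mul_comm (C * (m x).toReal), mul_div_assoc]
  exact mul_le_of_le_one_right ENNReal.toReal_nonneg
    (div_le_one_of_le₀ (le_add_of_nonneg_left hd) (add_nonneg hd hc))

lemma summable_novelty (h : ∀ x, (p t x).toReal ≤ C * (m x).toReal) :
    Summable (novelty p m C t) :=
  Summable.of_nonneg_of_le (fun x => novelty_nonneg (h x)) (fun x => novelty_le (h x))
    (summable_toReal (p t))

lemma sum_tsum_novelty_le (h : ∀ i x, (p i x).toReal ≤ C * (m x).toReal) (T : ℕ) :
    ∑ t ∈ Finset.range T, ∑' x, novelty p m C t x ≤ 2 * C * Real.log (1 + T) := by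
  have hsum : Summable fun x => C * (m x).toReal * (2 * Real.log (1 + T)) :=
    ((summable_toReal m).mul_left C).mul_right _
  calc ∑ t ∈ Finset.range T, ∑' x, novelty p m C t x
      = ∑' x, ∑ t ∈ Finset.range T, novelty p m C t x :=
        (Summable.tsum_finsetSum fun t _ => summable_novelty (h t)).symm
    _ ≤ ∑' x, C * (m x).toReal * (2 * Real.log (1 + T)) :=
        Summable.tsum_le_tsum
          (fun x => sum_mul_div_partialSum_le_log (fun _ => ENNReal.toReal_nonneg) (h · x) T)
          (summable_sum fun t _ => summable_novelty (h t)) hsum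
    _ = 2 * C * Real.log (1 + T) := by
        rw [tsum_mul_right, tsum_mul_left, tsum_toReal]
        ring

lemma expect_abs_le_novelty (h : ∀ x, (p t x).toReal ≤ C * (m x).toReal) {g : X → ℝ} {G η : ℝ}
    (hη : 0 < η) (hg : ∀ x ∈ (p t).support, |g x| ≤ G)
    (hsq : ∀ i < t, Integrable (p i) fun x => g x ^ 2) :
    expect (p t) (fun x => |g x|) ≤ (2 * G + 1 / η) * ∑' x, novelty p m C t x +
      η / 2 * ∑ i ∈ Finset.range t, expect (p i) (fun x => g x ^ 2) := by
  have hpointwise : ∀ x, (p t x).toReal * |g x| ≤ (2 * G + 1 / η) * novelty p m C t x +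
      η / 2 * ∑ i ∈ Finset.range t, (p i x).toReal * g x ^ 2 := by
    intro x
    have hd : 0 ≤ ∑ i ∈ Finset.range t, (p i x).toReal :=
      Finset.sum_nonneg fun _ _ => ENNReal.toReal_nonneg
    rw [← Finset.sum_mul]
    rcases (ENNReal.toReal_nonneg (a := p t x)).eq_or_lt with hp | hp
    · rw [novelty, ← hp, mul_zero, zero_div, mul_zero, zero_mul, zero_add]
      positivity
    · exact mul_abs_le_mul_ratio_add hp (h x) hd (hg x fun h0 => by simp [h0] at hp) hη
  have habs : Summable fun x => (p t x).toReal * |g x| :=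
    integrable_of_abs_le (B := G) fun x hx => (abs_abs (g x)).trans_le (hg x hx)
  have hsq' : ∀ i ∈ Finset.range t, Summable fun x => (p i x).toReal * g x ^ 2 := fun i hi =>
    hsq i (Finset.mem_range.1 hi)
  have hnovelty := (summable_novelty h).mul_left (2 * G + 1 / η)
  have hsqsum := (summable_sum hsq').mul_left (η / 2)
  calc expect (p t) (fun x => |g x|)
      ≤ ∑' x, ((2 * G + 1 / η) * novelty p m C t x +
          η / 2 * ∑ i ∈ Finset.range t, (p i x).toReal * g x ^ 2) :=
        Summable.tsum_le_tsum hpointwise habs (hnovelty.add hsqsum)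
    _ = _ := by
        rw [hnovelty.tsum_add hsqsum, tsum_mul_left, tsum_mul_left, Summable.tsum_finsetSum hsq']
        rfl

end Coverage

/-! ### Trajectory laws -/

section Rollout

variable {S A : Type*} {next : S → A → S} {π : Policy S A} {n : ℕ} {s : S} {τ : Fin n → S × A}

/-- The states of `τ` start at `s` and follow the transition map `next`; recursive over the steps,
to match the recursion of `rollout`. -/
def Follows (next : S → A → S) : (n : ℕ) → S → (Fin n → S × A) → Prop
  | 0, _, _ => True
  | n + 1, s, τ => (τ 0).1 = s ∧ Follows next n (next s (τ 0).2) (Fin.tail τ)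

lemma follows_iff :
    Follows next n s τ ↔ (∀ h : 0 < n, (τ ⟨0, h⟩).1 = s) ∧
      ∀ (h : ℕ) (hh : h + 1 < n), (τ ⟨h + 1, hh⟩).1 =
        next (τ ⟨h, Nat.lt_of_succ_lt hh⟩).1 (τ ⟨h, Nat.lt_of_succ_lt hh⟩).2 := by
  induction n generalizing s with
  | zero => simp [Follows]
  | succ n ih =>
    rw [Follows, ih]
    constructor
    · rintro ⟨rfl, hhead, htail⟩
      refine ⟨fun _ => rfl, fun h hh => ?_⟩
      cases h with
      | zero => exact hhead (Nat.lt_of_succ_lt_succ hh)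
      | succ h => exact htail h (Nat.lt_of_succ_lt_succ hh)
    · rintro ⟨hinit, hnext⟩
      obtain rfl := hinit n.succ_pos
      exact ⟨rfl, fun hn => hnext 0 (Nat.succ_lt_succ hn),
        fun h hh => hnext (h + 1) (Nat.succ_lt_succ hh)⟩

lemma follows_of_mem_support_rollout (h : τ ∈ (rollout next π n s).support) :
    Follows next n s τ := by
  induction n generalizing s with
  | zero => trivial
  | succ n ih =>
    rw [rollout, PMF.mem_support_bind_iff] at h
    obtain ⟨a, -, h⟩ := h
    obtain ⟨τ', hτ', rfl⟩ := (PMF.mem_support_map_iff _ _ _).1 h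
    exact ⟨rfl, ih hτ'⟩

lemma map_cons_apply_cons (q : PMF (Fin n → S × A)) (x : S × A) :
    (q.map fun τ' => (Fin.cons x τ' : Fin (n + 1) → S × A)) (Fin.cons x τ) = q τ := by
  have hne : ∀ τ' ≠ τ, (Fin.cons x τ : Fin (n + 1) → S × A) ≠ Fin.cons x τ' := fun τ' h h' =>
    h (Fin.cons_right_injective _ h').symm
  rw [PMF.map_apply, tsum_eq_single τ fun τ' h => if_neg (hne τ' h), if_pos rfl]

lemma rollout_apply (h : Follows next n s τ) :
    rollout next π n s τ = ∏ i, π (τ i).1 (τ i).2 := by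
  induction n generalizing s with
  | zero => rw [Fin.prod_univ_zero, Subsingleton.elim τ Fin.elim0, rollout, PMF.pure_apply_self]
  | succ n ih =>
    obtain ⟨rfl, h⟩ := h
    rw [rollout, PMF.bind_apply, tsum_eq_single (τ 0).2, Fin.prod_univ_succ]
    · conv_lhs => rw [← Fin.cons_self_tail τ]
      rw [Fin.cons_zero, Prod.mk.eta, map_cons_apply_cons, ih h]
      rfl
    · refine fun a ha => mul_eq_zero_of_right _ ?_
      rw [PMF.apply_eq_zero_iff, PMF.mem_support_map_iff]
      rintro ⟨τ', -, hτ⟩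
      exact ha (by rw [← hτ, Fin.cons_zero])

end Rollout

namespace DCMDP

variable {S A : Type*} (M : DCMDP S A) {π : Policy S A} {s : S} {τ : M.Traj}

/-- The initial state `s₁` of a trajectory. -/
def initState (τ : M.Traj) : S := (τ ⟨0, M.H_pos⟩).1

lemma admissible_iff :
    M.Admissible τ ↔ M.initState τ ∈ M.ρ.support ∧ Follows M.next M.H (M.initState τ) τ := by
  rw [follows_iff]
  exact ⟨fun h => ⟨h.1, fun _ => rfl, h.2⟩, fun h => ⟨h.1, h.2.2⟩⟩

lemma initState_of_mem_support_trajLawFrom (h : τ ∈ (M.trajLawFrom π s).support) :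
    M.initState τ = s :=
  (follows_iff.1 (follows_of_mem_support_rollout h)).1 M.H_pos

lemma admissible_of_mem_support_trajLawFrom (hs : s ∈ M.ρ.support)
    (h : τ ∈ (M.trajLawFrom π s).support) : M.Admissible τ := by
  rw [admissible_iff, M.initState_of_mem_support_trajLawFrom h]
  exact ⟨hs, follows_of_mem_support_rollout h⟩

lemma toReal_trajLawFrom (h : Follows M.next M.H s τ) :
    (M.trajLawFrom π s τ).toReal = M.prob π τ := by
  rw [trajLawFrom, rollout_apply h, ENNReal.toReal_prod, prob]

lemma trajLaw_apply (π : Policy S A) (τ : M.Traj) :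
    M.trajLaw π τ = M.ρ (M.initState τ) * M.trajLawFrom π (M.initState τ) τ := by
  rw [trajLaw, PMF.bind_apply, tsum_eq_single (M.initState τ)]
  intro s hs
  by_contra h
  exact hs (M.initState_of_mem_support_trajLawFrom (right_ne_zero_of_mul h)).symm

lemma toReal_trajLaw (h : M.Admissible τ) :
    (M.trajLaw π τ).toReal = (M.ρ (M.initState τ)).toReal * M.prob π τ := by
  rw [trajLaw_apply, ENNReal.toReal_mul, M.toReal_trajLawFrom (M.admissible_iff.1 h).2]

lemma mem_support_trajLaw :
    τ ∈ (M.trajLaw π).support ↔ M.Admissible τ ∧ M.prob π τ ≠ 0 := by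
  have hadm : τ ∈ (M.trajLaw π).support → M.Admissible τ := fun h => by
    rw [PMF.mem_support_iff, trajLaw_apply] at h
    exact M.admissible_of_mem_support_trajLawFrom (left_ne_zero_of_mul h) (right_ne_zero_of_mul h)
  rw [← and_iff_right_of_imp hadm]
  refine and_congr_right fun h => ?_
  have hρ : (M.ρ (M.initState τ)).toReal ≠ 0 :=
    ENNReal.toReal_ne_zero.2 ⟨(M.admissible_iff.1 h).1, M.ρ.apply_ne_top _⟩
  rw [← mul_ne_zero_iff_left hρ, ← M.toReal_trajLaw h, ENNReal.toReal_ne_zero,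
    and_iff_left ((M.trajLaw π).apply_ne_top τ), PMF.mem_support_iff]

lemma integrable_trajLaw_initState {f : S → ℝ} :
    Integrable (M.trajLaw π) (fun τ => f (M.initState τ)) ↔ Integrable M.ρ f := by
  rw [trajLaw, integrable_bind_iff, integrable_iff_lexpect_enorm_ne_top]
  congr! 2
  funext s
  rw [lexpect_congr fun τ hτ => by rw [M.initState_of_mem_support_trajLawFrom hτ], lexpect_const]

lemma expect_trajLaw_initState (π : Policy S A) {f : S → ℝ} (hf : Integrable M.ρ f) :
    expect (M.trajLaw π) (fun τ => f (M.initState τ)) = expect M.ρ f := by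
  rw [trajLaw, expect_bind (M.integrable_trajLaw_initState.2 hf)]
  refine expect_congr fun s _ => ?_
  rw [expect_congr fun τ hτ => by rw [M.initState_of_mem_support_trajLawFrom hτ], expect_const]

end DCMDP

/-! ### The soft-optimal policy -/

namespace DCMDP

variable {S A : Type*} (M : DCMDP S A) {πref π πstar : Policy S A} {β Rmax : ℝ} {s : S}
  {τ : M.Traj}

/-- The partition function of the Gibbs measure with density proportional to `exp (r / β)` with
respect to the next `n` steps of `π` from the state `s`. -/
def partition (β : ℝ) (π : Policy S A) (n : ℕ) (s : S) : ℝ≥0∞ :=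
  lexpect (rollout M.next π n s) fun τ =>
    ENNReal.ofReal (Real.exp ((∑ h, M.r (τ h).1 (τ h).2) / β))

lemma partition_zero : M.partition β π 0 s = 1 := by
  simp [partition, rollout, lexpect_pure]

lemma partition_succ (n : ℕ) :
    M.partition β π (n + 1) s = ∑' a, π s a *
      (ENNReal.ofReal (Real.exp (M.r s a / β)) * M.partition β π n (M.next s a)) := by
  simp only [partition, rollout, lexpect_bind, lexpect_map, Fin.sum_univ_succ, Fin.cons_zero,
    Fin.cons_succ, add_div, Real.exp_add, ENNReal.ofReal_mul (Real.exp_pos _).le,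
    lexpect_const_mul]
  rfl

lemma partition_ne_zero (n : ℕ) : M.partition β π n s ≠ 0 := by
  obtain ⟨τ, hτ⟩ := (rollout M.next π n s).support_nonempty
  exact fun h => mul_ne_zero hτ (ENNReal.ofReal_pos.2 (Real.exp_pos _)).ne'
    (ENNReal.tsum_eq_zero.1 h τ)

/-- The unnormalized probability `π(a | s) exp (Q(s, a) / β)` of an action under the soft-optimal
policy, where `Q` is the soft action value; `M.H - (M.layer s + 1)` steps remain after `a`. -/
def softWeight (β : ℝ) (π : Policy S A) (s : S) (a : A) : ℝ≥0∞ :=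
  π s a * (ENNReal.ofReal (Real.exp (M.r s a / β)) *
    M.partition β π (M.H - (M.layer s + 1)) (M.next s a))

lemma tsum_softWeight (β : ℝ) (π : Policy S A) (s : S) :
    ∑' a, M.softWeight β π s a = M.partition β π (M.H - (M.layer s + 1) + 1) s :=
  (M.partition_succ _).symm

open Classical in
/-- The soft-optimal policy with reference `π`, the maximizer of the KL-regularized objective; it
is `π` in states where the partition function is infinite. -/
def softPolicy (β : ℝ) (π : Policy S A) : Policy S A := fun s =>
  if h : ∑' a, M.softWeight β π s a ≠ ⊤ then
    PMF.normalize (M.softWeight β π s) (M.tsum_softWeight β π s ▸ M.partition_ne_zero _) h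
  else π s

lemma softPolicy_mul_partition {n : ℕ} (hn : (M.layer s : ℕ) + (n + 1) = M.H)
    (h : M.partition β π (n + 1) s ≠ ⊤) (a : A) :
    M.softPolicy β π s a * M.partition β π (n + 1) s =
      π s a * (ENNReal.ofReal (Real.exp (M.r s a / β)) * M.partition β π n (M.next s a)) := by
  obtain rfl : n = M.H - (M.layer s + 1) := by omega
  rw [← tsum_softWeight] at h ⊢
  rw [softPolicy, dif_pos h, PMF.normalize_apply, mul_assoc,
    ENNReal.inv_mul_cancel (M.tsum_softWeight β π s ▸ M.partition_ne_zero _) h, mul_one,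
    softWeight]

lemma partition_next_ne_top {n : ℕ} (h : M.partition β π (n + 1) s ≠ ⊤) {a : A} (ha : π s a ≠ 0) :
    M.partition β π n (M.next s a) ≠ ⊤ := by
  rw [partition_succ] at h
  exact fun htop => ENNReal.ne_top_of_tsum_ne_top h a (by
    rw [htop, ENNReal.mul_top (ENNReal.ofReal_pos.2 (Real.exp_pos _)).ne', ENNReal.mul_top ha])

lemma prod_softPolicy_mul_partition {n : ℕ} {τ : Fin n → S × A} (hτ : Follows M.next n s τ)
    (hn : 0 < n → (M.layer s : ℕ) + n = M.H) (h : M.partition β π n s ≠ ⊤) :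
    (∏ i, M.softPolicy β π (τ i).1 (τ i).2) * M.partition β π n s =
      (∏ i, π (τ i).1 (τ i).2) *
        ENNReal.ofReal (Real.exp ((∑ i, M.r (τ i).1 (τ i).2) / β)) := by
  induction n generalizing s with
  | zero => simp [partition_zero]
  | succ n ih =>
    obtain ⟨rfl, hτ⟩ := hτ
    have hlayer := hn n.succ_pos
    have hstep := M.softPolicy_mul_partition hlayer h (τ 0).2
    rw [Fin.prod_univ_succ, Fin.prod_univ_succ, Fin.sum_univ_succ, mul_right_comm, hstep, add_div,
      Real.exp_add, ENNReal.ofReal_mul (Real.exp_pos _).le]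
    by_cases ha : π (τ 0).1 (τ 0).2 = 0
    · simp only [ha, zero_mul]
    have htail := ih hτ (fun hpos => by rw [M.layer_next _ _ (by omega)]; omega)
      (M.partition_next_ne_top h ha)
    calc _ = π (τ 0).1 (τ 0).2 * ENNReal.ofReal (Real.exp (M.r (τ 0).1 (τ 0).2 / β)) *
          ((∏ i, M.softPolicy β π (Fin.tail τ i).1 (Fin.tail τ i).2) *
            M.partition β π n (M.next (τ 0).1 (τ 0).2)) := by
          simp only [Fin.tail]
          ring
      _ = _ := by
          rw [htail]
          simp only [Fin.tail]
          ring

/-- The soft value `β log Z(s)` of an initial state. -/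
def softValue (β : ℝ) (π : Policy S A) (s : S) : ℝ :=
  β * Real.log (M.partition β π M.H s).toReal

/-- The total reward of every admissible trajectory lies in `[0, Rmax]`. -/
def BoundedRewards (Rmax : ℝ) : Prop :=
  ∀ τ : M.Traj, M.Admissible τ → 0 ≤ M.reward τ ∧ M.reward τ ≤ Rmax

variable {M}

lemma BoundedRewards.partition_mem_Icc (hr : M.BoundedRewards Rmax) (hβ : 0 < β)
    (hs : s ∈ M.ρ.support) :
    M.partition β π M.H s ∈ Set.Icc 1 (ENNReal.ofReal (Real.exp (Rmax / β))) := by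
  have hreward : ∀ τ ∈ (rollout M.next π M.H s).support, 0 ≤ M.reward τ ∧ M.reward τ ≤ Rmax :=
    fun τ hτ => hr τ (M.admissible_of_mem_support_trajLawFrom hs hτ)
  constructor
  · rw [← lexpect_const (rollout M.next π M.H s) 1]
    refine lexpect_mono fun τ hτ => ?_
    rw [ENNReal.one_le_ofReal, Real.one_le_exp_iff]
    exact div_nonneg (hreward τ hτ).1 hβ.le
  · rw [← lexpect_const (rollout M.next π M.H s) (ENNReal.ofReal _)]
    refine lexpect_mono fun τ hτ => ?_
    gcongr
    exact (hreward τ hτ).2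

lemma BoundedRewards.softValue_mem_Icc (hr : M.BoundedRewards Rmax) (hβ : 0 < β)
    (hs : s ∈ M.ρ.support) : M.softValue β π s ∈ Set.Icc 0 Rmax := by
  obtain ⟨hone, hexp⟩ := hr.partition_mem_Icc (π := π) hβ hs
  have hone' : 1 ≤ (M.partition β π M.H s).toReal := by
    simpa using ENNReal.toReal_mono (ne_top_of_le_ne_top ENNReal.ofReal_ne_top hexp) hone
  refine ⟨mul_nonneg hβ.le (Real.log_nonneg hone'), ?_⟩
  calc M.softValue β π s ≤ β * (Rmax / β) := by
        rw [softValue]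
        gcongr
        exact (Real.log_le_iff_le_exp (one_pos.trans_le hone')).2
          (ENNReal.toReal_le_of_le_ofReal (Real.exp_pos _).le hexp)
    _ = Rmax := mul_div_cancel₀ _ hβ.ne'

lemma BoundedRewards.integrable_softValue (hr : M.BoundedRewards Rmax) (hβ : 0 < β) :
    Integrable M.ρ (M.softValue β π) :=
  integrable_of_abs_le fun _ hs => by
    obtain ⟨h0, hle⟩ := hr.softValue_mem_Icc (π := π) hβ hs
    exact (abs_of_nonneg h0).trans_le hle

lemma BoundedRewards.integrable_reward (hr : M.BoundedRewards Rmax) :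
    Integrable (M.trajLaw π) M.reward :=
  integrable_of_abs_le fun τ hτ => by
    obtain ⟨h0, hle⟩ := hr τ (M.mem_support_trajLaw.1 hτ).1
    exact (abs_of_nonneg h0).trans_le hle

lemma BoundedRewards.prob_softPolicy (hr : M.BoundedRewards Rmax) (hβ : 0 < β)
    (hτ : M.Admissible τ) :
    M.prob (M.softPolicy β π) τ =
      M.prob π τ * Real.exp ((M.reward τ - M.softValue β π (M.initState τ)) / β) := by
  obtain ⟨hs, hfollows⟩ := M.admissible_iff.1 hτ
  have htop := ne_top_of_le_ne_top ENNReal.ofReal_ne_top (hr.partition_mem_Icc (π := π) hβ hs).2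
  have hpos := ENNReal.toReal_pos (M.partition_ne_zero M.H) htop
  have h := congrArg ENNReal.toReal (M.prod_softPolicy_mul_partition hfollows
    (fun _ => by rw [M.layer_init _ hs, zero_add]) htop)
  rw [ENNReal.toReal_mul, ENNReal.toReal_mul, ENNReal.toReal_prod, ENNReal.toReal_prod,
    ENNReal.toReal_ofReal (Real.exp_pos _).le] at h
  rw [sub_div, softValue, mul_div_cancel_left₀ _ hβ.ne', Real.exp_sub, Real.exp_log hpos,
    mul_div_assoc', eq_div_iff hpos.ne']
  exact h

lemma BoundedRewards.prob_softPolicy_ne_zero_iff (hr : M.BoundedRewards Rmax) (hβ : 0 < β)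
    (hτ : M.Admissible τ) : M.prob (M.softPolicy β π) τ ≠ 0 ↔ M.prob π τ ≠ 0 := by
  rw [hr.prob_softPolicy hβ hτ, mul_ne_zero_iff_right (Real.exp_pos _).ne']

lemma BoundedRewards.logRatio_softPolicy (hr : M.BoundedRewards Rmax) (hβ : 0 < β)
    (hτ : M.Admissible τ) (h0 : M.prob πref τ ≠ 0) :
    β * M.logRatio πref (M.softPolicy β πref) τ =
      M.reward τ - M.softValue β πref (M.initState τ) := by
  rw [logRatio, hr.prob_softPolicy hβ hτ, mul_div_cancel_left₀ _ h0, Real.log_exp,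
    mul_div_cancel₀ _ hβ.ne']

lemma J_eq_expect (h0 : ∀ τ ∈ (M.trajLaw π).support, M.prob πref τ ≠ 0)
    (hint : Integrable (M.trajLaw π) (M.logRatio πref π)) :
    M.J πref β π = ↑(expect (M.trajLaw π) fun τ => M.reward τ - β * M.logRatio πref π τ) :=
  if_pos ⟨h0, hint⟩

lemma integrable_of_J_ne_bot (h : M.J πref β π ≠ ⊥) :
    (∀ τ ∈ (M.trajLaw π).support, M.prob πref τ ≠ 0) ∧
      Integrable (M.trajLaw π) (M.logRatio πref π) :=
  by_contra fun hnot => h (if_neg hnot)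

lemma BoundedRewards.log_trajLaw_div (hr : M.BoundedRewards Rmax) (hβ : 0 < β)
    (hτ : τ ∈ (M.trajLaw π).support) (h0 : M.prob πref τ ≠ 0) :
    β * Real.log ((M.trajLaw π τ).toReal / (M.trajLaw (M.softPolicy β πref) τ).toReal) =
      M.softValue β πref (M.initState τ) - (M.reward τ - β * M.logRatio πref π τ) := by
  obtain ⟨hadm, hπ⟩ := M.mem_support_trajLaw.1 hτ
  have hρ : (M.ρ (M.initState τ)).toReal ≠ 0 :=
    ENNReal.toReal_ne_zero.2 ⟨(M.admissible_iff.1 hadm).1, M.ρ.apply_ne_top _⟩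
  rw [M.toReal_trajLaw hadm, M.toReal_trajLaw hadm, mul_div_mul_left _ _ hρ,
    hr.prob_softPolicy hβ hadm, ← div_div, Real.log_div (div_ne_zero hπ h0) (Real.exp_pos _).ne',
    Real.log_exp, mul_sub, mul_div_cancel₀ _ hβ.ne', logRatio]
  ring

lemma BoundedRewards.integrable_log_trajLaw_div (hr : M.BoundedRewards Rmax) (hβ : 0 < β)
    (h0 : ∀ τ ∈ (M.trajLaw π).support, M.prob πref τ ≠ 0)
    (hint : Integrable (M.trajLaw π) (M.logRatio πref π)) :
    Integrable (M.trajLaw π) fun τ =>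
      Real.log ((M.trajLaw π τ).toReal / (M.trajLaw (M.softPolicy β πref) τ).toReal) := by
  have hvalue := M.integrable_trajLaw_initState (π := π).2 (hr.integrable_softValue (π := πref) hβ)
  refine ((hvalue.sub (hr.integrable_reward.sub (hint.const_mul β))).const_mul β⁻¹).congr
    fun τ hτ => ?_
  rw [← hr.log_trajLaw_div hβ hτ (h0 τ hτ), inv_mul_cancel_left₀ hβ.ne']

/-- The **Gibbs variational principle**. -/
lemma BoundedRewards.J_eq_softValue_sub (hr : M.BoundedRewards Rmax) (hβ : 0 < β)
    (h0 : ∀ τ ∈ (M.trajLaw π).support, M.prob πref τ ≠ 0)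
    (hint : Integrable (M.trajLaw π) (M.logRatio πref π)) :
    M.J πref β π = ↑(expect M.ρ (M.softValue β πref) - β * expect (M.trajLaw π) fun τ =>
      Real.log ((M.trajLaw π τ).toReal / (M.trajLaw (M.softPolicy β πref) τ).toReal)) := by
  have hvalue := hr.integrable_softValue (π := πref) hβ
  rw [J_eq_expect h0 hint, ← M.expect_trajLaw_initState π hvalue, ← expect_const_mul, ← expect_sub
    (M.integrable_trajLaw_initState.2 hvalue)
    ((hr.integrable_log_trajLaw_div hβ h0 hint).const_mul β)]
  refine congrArg _ (expect_congr fun τ hτ => ?_)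
  rw [hr.log_trajLaw_div hβ hτ (h0 τ hτ)]
  ring

lemma BoundedRewards.J_softPolicy (hr : M.BoundedRewards Rmax) (hβ : 0 < β) :
    M.J πref β (M.softPolicy β πref) = ↑(expect M.ρ (M.softValue β πref)) := by
  have h0 : ∀ τ ∈ (M.trajLaw (M.softPolicy β πref)).support, M.prob πref τ ≠ 0 := fun τ hτ =>
    have hτ := M.mem_support_trajLaw.1 hτ
    (hr.prob_softPolicy_ne_zero_iff hβ hτ.1).1 hτ.2
  have hint : Integrable (M.trajLaw (M.softPolicy β πref))
      (M.logRatio πref (M.softPolicy β πref)) := by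
    refine ((hr.integrable_reward.sub (M.integrable_trajLaw_initState.2
      (hr.integrable_softValue (π := πref) hβ))).const_mul β⁻¹).congr fun τ hτ => ?_
    rw [← hr.logRatio_softPolicy hβ (M.mem_support_trajLaw.1 hτ).1 (h0 τ hτ),
      inv_mul_cancel_left₀ hβ.ne']
  have hself : expect (M.trajLaw (M.softPolicy β πref)) (fun τ =>
      Real.log ((M.trajLaw (M.softPolicy β πref) τ).toReal /
        (M.trajLaw (M.softPolicy β πref) τ).toReal)) = 0 := by
    simp [expect]
  rw [hr.J_eq_softValue_sub hβ h0 hint, hself, mul_zero, sub_zero]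

lemma IsOptimal.trajLaw_eq (hopt : M.IsOptimal πref β πstar) (hr : M.BoundedRewards Rmax)
    (hβ : 0 < β) : M.trajLaw πstar = M.trajLaw (M.softPolicy β πref) := by
  have hJ := hopt (M.softPolicy β πref)
  rw [hr.J_softPolicy hβ] at hJ
  obtain ⟨h0, hint⟩ := integrable_of_J_ne_bot (ne_bot_of_le_ne_bot (EReal.coe_ne_bot _) hJ)
  rw [hr.J_eq_softValue_sub hβ h0 hint, EReal.coe_le_coe_iff] at hJ
  refine eq_of_expect_log_div_nonpos (fun τ hτ => ?_)
    (hr.integrable_log_trajLaw_div hβ h0 hint) ?_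
  · have hadm := (M.mem_support_trajLaw.1 hτ).1
    exact M.mem_support_trajLaw.2 ⟨hadm, (hr.prob_softPolicy_ne_zero_iff hβ hadm).2 (h0 τ hτ)⟩
  · exact nonpos_of_mul_nonpos_right (by linarith) hβ

lemma IsOptimal.logRatio_eq (hopt : M.IsOptimal πref β πstar) (hr : M.BoundedRewards Rmax)
    (hβ : 0 < β) (hτ : M.Admissible τ) (h0 : M.prob πref τ ≠ 0) :
    β * M.logRatio πref πstar τ = M.reward τ - M.softValue β πref (M.initState τ) := by
  have hρ : (M.ρ (M.initState τ)).toReal ≠ 0 :=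
    ENNReal.toReal_ne_zero.2 ⟨(M.admissible_iff.1 hτ).1, M.ρ.apply_ne_top _⟩
  have hlaw := congrArg (fun p => (p τ).toReal) (hopt.trajLaw_eq hr hβ)
  simp only [M.toReal_trajLaw hτ] at hlaw
  rw [← hr.logRatio_softPolicy hβ hτ h0, logRatio, logRatio, mul_left_cancel₀ hρ hlaw]

end DCMDP

/-! ### Pairs of trajectories -/

lemma bind_congr_support {X Y : Type*} {p : PMF X} {f g : X → PMF Y}
    (h : ∀ x ∈ p.support, f x = g x) : p.bind f = p.bind g := by
  ext y
  rw [PMF.bind_apply, PMF.bind_apply]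
  refine tsum_congr fun x => ?_
  by_cases hx : p x = 0
  · rw [hx, zero_mul, zero_mul]
  · rw [h x hx]

namespace DCMDP

variable {S A : Type*} (M : DCMDP S A) {πref πstar π : Policy S A} {β Rmax Vmax : ℝ}
  {Pi : Finset (Policy S A)} {τ : M.Traj} {x : M.Traj × M.Traj}

/-- The law of a trajectory drawn from `q` together with a trajectory of `πref` with the same
initial state; for `q = M.trajLaw π` these are the two responses that are compared in one round. -/
def pairLaw (πref : Policy S A) (q : PMF M.Traj) : PMF (M.Traj × M.Traj) :=
  q.bind fun τ => (M.trajLawFrom πref (M.initState τ)).map (Prod.mk τ)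

lemma map_initState_trajLaw (π : Policy S A) : (M.trajLaw π).map M.initState = M.ρ := by
  conv_rhs => rw [← PMF.bind_pure M.ρ]
  rw [trajLaw, PMF.map_bind]
  refine bind_congr_support fun s _ => ?_
  rw [← PMF.bind_pure_comp, bind_congr_support (g := fun _ => PMF.pure s) fun τ hτ => by
    rw [Function.comp_apply, M.initState_of_mem_support_trajLawFrom hτ], PMF.bind_const]

lemma map_fst_pairLaw (πref : Policy S A) (q : PMF M.Traj) :
    (M.pairLaw πref q).map Prod.fst = q := by
  conv_rhs => rw [← PMF.bind_pure q]
  rw [pairLaw, PMF.map_bind]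
  congr 1
  funext τ
  rw [PMF.map_comp]
  exact PMF.map_const _ _

lemma map_snd_pairLaw (πref π : Policy S A) :
    (M.pairLaw πref (M.trajLaw π)).map Prod.snd = M.trajLaw πref := by
  have hsnd : ∀ τ, ((M.trajLawFrom πref (M.initState τ)).map (Prod.mk τ)).map Prod.snd =
      M.trajLawFrom πref (M.initState τ) := fun τ => by
    rw [PMF.map_comp]
    exact PMF.map_id _
  conv_rhs => rw [trajLaw, ← M.map_initState_trajLaw π, PMF.bind_map]
  rw [pairLaw, PMF.map_bind, funext hsnd]
  rfl

lemma pairLaw_apply (πref : Policy S A) (q : PMF M.Traj) (x : M.Traj × M.Traj) :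
    M.pairLaw πref q x = q x.1 * M.trajLawFrom πref (M.initState x.1) x.2 := by
  rw [pairLaw, PMF.bind_apply, tsum_eq_single x.1, PMF.map_apply, tsum_eq_single x.2]
  · rw [if_pos rfl]
  · exact fun τ' h => if_neg fun h' => h (congrArg Prod.snd h').symm
  · refine fun τ h => mul_eq_zero_of_right _ ?_
    rw [PMF.apply_eq_zero_iff, PMF.mem_support_map_iff]
    rintro ⟨τ', -, hτ'⟩
    exact h (congrArg Prod.fst hτ')

lemma roundLaw_eq_bind_pairLaw (πref π : Policy S A) :
    M.roundLaw πref π = (M.pairLaw πref (M.trajLaw π)).bind fun x =>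
      (M.bradleyTerry x.1 x.2).map fun y => ⟨x.1, x.2, y⟩ := by
  rw [roundLaw, pairLaw, trajLaw, PMF.bind_bind, PMF.bind_bind]
  refine bind_congr_support fun s _ => bind_congr_support fun τ hτ => ?_
  rw [M.initState_of_mem_support_trajLawFrom hτ, PMF.bind_map]
  rfl

variable {M}

lemma of_mem_support_pairLaw {q : PMF M.Traj} (hq : q.support ⊆ (M.trajLaw πref).support)
    (hx : x ∈ (M.pairLaw πref q).support) :
    x.1 ∈ (M.trajLaw πref).support ∧ x.2 ∈ (M.trajLaw πref).support ∧
      M.initState x.1 = M.initState x.2 := by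
  rw [PMF.mem_support_iff, pairLaw_apply] at hx
  have hfst := hq (show x.1 ∈ q.support from left_ne_zero_of_mul hx)
  have hsnd : x.2 ∈ (M.trajLawFrom πref (M.initState x.1)).support := right_ne_zero_of_mul hx
  have hinit := M.initState_of_mem_support_trajLawFrom hsnd
  refine ⟨hfst, ?_, hinit.symm⟩
  rw [PMF.mem_support_iff, trajLaw_apply, hinit]
  exact mul_ne_zero (M.admissible_iff.1 (M.mem_support_trajLaw.1 hfst).1).1 hsnd

/-! ### The implicit reward -/

lemma BoundedRatios.support_subset (hb : M.BoundedRatios πref β Vmax Pi) (hπ : π ∈ Pi) :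
    (M.trajLaw π).support ⊆ (M.trajLaw πref).support := by
  intro τ hτ
  rw [mem_support_trajLaw] at hτ ⊢
  exact ⟨hτ.1, fun h => hτ.2 ((hb π hπ τ hτ.1).1.2 h)⟩

lemma BoundedRatios.logRatio_eq (hb : M.BoundedRatios πref β Vmax Pi) (hπ : π ∈ Pi)
    (hτ : τ ∈ (M.trajLaw πref).support) :
    M.logRatio πref π τ = Real.log (M.prob π τ) - Real.log (M.prob πref τ) := by
  obtain ⟨hadm, h0⟩ := M.mem_support_trajLaw.1 hτ
  exact Real.log_div (fun h => h0 ((hb π hπ τ hadm).1.1 h)) h0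

lemma BoundedRatios.abs_mul_logRatio_le (hb : M.BoundedRatios πref β Vmax Pi) (hβ : 0 < β)
    (hπ : π ∈ Pi) (hτ : τ ∈ (M.trajLaw πref).support) : |β * M.logRatio πref π τ| ≤ Vmax := by
  rw [abs_mul, abs_of_pos hβ, mul_comm, ← le_div_iff₀ hβ]
  exact (hb π hπ τ (M.mem_support_trajLaw.1 hτ).1).2

lemma BoundedRatios.Vmax_nonneg (hb : M.BoundedRatios πref β Vmax Pi) (hβ : 0 < β) (hπ : π ∈ Pi) :
    0 ≤ Vmax := by
  obtain ⟨τ, hτ⟩ := (M.trajLaw πref).support_nonempty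
  exact (abs_nonneg _).trans (hb.abs_mul_logRatio_le hβ hπ hτ)

variable (M)

/-- The logit of the preference for the first trajectory under the model whose implicit reward is
`β log (π / πref)`. -/
def logit (πref : Policy S A) (β : ℝ) (π : Policy S A) (x : M.Traj × M.Traj) : ℝ :=
  β * M.logRatio πref π x.1 - β * M.logRatio πref π x.2

/-- The logit of the Bradley-Terry preference for the first trajectory. -/
def rewardGap (x : M.Traj × M.Traj) : ℝ := M.reward x.1 - M.reward x.2

/-- The expected log-ratio between `π` and `πstar` under the reference policy, which the optimism
term of the algorithm controls. -/
def logGap (πref πstar π : Policy S A) : ℝ :=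
  expect (M.trajLaw πref) fun τ => Real.log (M.prob π τ) - Real.log (M.prob πstar τ)

/-- The reward minus the implicit reward of `π`, whose expectation under `π` is the objective. -/
def regReward (πref : Policy S A) (β : ℝ) (π : Policy S A) (τ : M.Traj) : ℝ :=
  M.reward τ - β * M.logRatio πref π τ

/-- The regularized objective as a real number, meaningful if the objective is finite. -/
def value (πref : Policy S A) (β : ℝ) (π : Policy S A) : ℝ :=
  expect (M.trajLaw π) (M.regReward πref β π)

variable {M}

lemma BoundedRewards.abs_rewardGap_le (hr : M.BoundedRewards Rmax)
    (hfst : x.1 ∈ (M.trajLaw πref).support) (hsnd : x.2 ∈ (M.trajLaw πref).support) :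
    |M.rewardGap x| ≤ Rmax := by
  have hr₁ := hr _ (M.mem_support_trajLaw.1 hfst).1
  have hr₂ := hr _ (M.mem_support_trajLaw.1 hsnd).1
  exact abs_le.2 ⟨by rw [rewardGap]; linarith, by rw [rewardGap]; linarith⟩

lemma BoundedRatios.abs_logit_sub_rewardGap_le (hb : M.BoundedRatios πref β Vmax Pi)
    (hr : M.BoundedRewards Rmax) (hβ : 0 < β) (hπ : π ∈ Pi)
    (hfst : x.1 ∈ (M.trajLaw πref).support) (hsnd : x.2 ∈ (M.trajLaw πref).support) :
    |M.logit πref β π x - M.rewardGap x| ≤ 2 * Vmax + Rmax :=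
  calc _ ≤ |M.logit πref β π x| + |M.rewardGap x| := abs_sub _ _
    _ ≤ (|β * M.logRatio πref π x.1| + |β * M.logRatio πref π x.2|) + |M.rewardGap x| := by
      gcongr
      exact abs_sub _ _
    _ ≤ (Vmax + Vmax) + Rmax := by
      gcongr
      exacts [hb.abs_mul_logRatio_le hβ hπ hfst, hb.abs_mul_logRatio_le hβ hπ hsnd,
        hr.abs_rewardGap_le hfst hsnd]
    _ = 2 * Vmax + Rmax := by ring

lemma IsOptimal.regReward_eq (hopt : M.IsOptimal πref β πstar) (hr : M.BoundedRewards Rmax)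
    (hβ : 0 < β) (hτ : τ ∈ (M.trajLaw πref).support) :
    M.regReward πref β πstar τ = M.softValue β πref (M.initState τ) := by
  obtain ⟨hadm, h0⟩ := M.mem_support_trajLaw.1 hτ
  rw [regReward, hopt.logRatio_eq hr hβ hadm h0, sub_sub_cancel]

lemma IsOptimal.logit_eq_rewardGap (hopt : M.IsOptimal πref β πstar) (hr : M.BoundedRewards Rmax)
    (hβ : 0 < β) (hfst : x.1 ∈ (M.trajLaw πref).support)
    (hsnd : x.2 ∈ (M.trajLaw πref).support) (hinit : M.initState x.1 = M.initState x.2) :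
    M.logit πref β πstar x = M.rewardGap x := by
  have hreg : M.regReward πref β πstar x.1 = M.regReward πref β πstar x.2 := by
    rw [hopt.regReward_eq hr hβ hfst, hopt.regReward_eq hr hβ hsnd, hinit]
  rw [regReward, regReward] at hreg
  rw [logit, rewardGap]
  linarith

lemma BoundedRatios.abs_log_sub_log_le (hb : M.BoundedRatios πref β Vmax Pi)
    (hstar : πstar ∈ Pi) (hπ : π ∈ Pi) (hτ : τ ∈ (M.trajLaw πref).support) :
    |Real.log (M.prob π τ) - Real.log (M.prob πstar τ)| ≤ 2 * Vmax / β := by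
  have hadm := (M.mem_support_trajLaw.1 hτ).1
  calc _ = |M.logRatio πref π τ - M.logRatio πref πstar τ| := by
        rw [hb.logRatio_eq hπ hτ, hb.logRatio_eq hstar hτ, sub_sub_sub_cancel_right]
    _ ≤ |M.logRatio πref π τ| + |M.logRatio πref πstar τ| := abs_sub _ _
    _ ≤ Vmax / β + Vmax / β := add_le_add (hb π hπ τ hadm).2 (hb πstar hstar τ hadm).2
    _ = 2 * Vmax / β := by ring

/-! ### The regret decomposition -/

lemma BoundedRatios.J_eq_value (hb : M.BoundedRatios πref β Vmax Pi) (hπ : π ∈ Pi) :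
    M.J πref β π = (M.value πref β π : EReal) :=
  J_eq_expect (fun _ hτ => (M.mem_support_trajLaw.1 (hb.support_subset hπ hτ)).2)
    (integrable_of_abs_le fun τ hτ => (hb π hπ τ (M.mem_support_trajLaw.1 hτ).1).2)

lemma BoundedRatios.abs_regReward_le (hb : M.BoundedRatios πref β Vmax Pi)
    (hr : M.BoundedRewards Rmax) (hβ : 0 < β) (hπ : π ∈ Pi)
    (hτ : τ ∈ (M.trajLaw πref).support) : |M.regReward πref β π τ| ≤ Rmax + Vmax := by
  obtain ⟨h0, hle⟩ := hr τ (M.mem_support_trajLaw.1 hτ).1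
  exact (abs_sub _ _).trans (add_le_add ((abs_of_nonneg h0).trans_le hle)
    (hb.abs_mul_logRatio_le hβ hπ hτ))

lemma IsOptimal.expect_regReward (hopt : M.IsOptimal πref β πstar) (hr : M.BoundedRewards Rmax)
    (hβ : 0 < β) (hπ : (M.trajLaw π).support ⊆ (M.trajLaw πref).support) :
    expect (M.trajLaw π) (M.regReward πref β πstar) = expect M.ρ (M.softValue β πref) := by
  rw [expect_congr fun τ hτ => hopt.regReward_eq hr hβ (hπ hτ),
    M.expect_trajLaw_initState _ (hr.integrable_softValue hβ)]

lemma BoundedRatios.mul_logGap (hb : M.BoundedRatios πref β Vmax Pi) (hr : M.BoundedRewards Rmax)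
    (hβ : 0 < β) (hstar : πstar ∈ Pi) (hπ : π ∈ Pi) :
    β * M.logGap πref πstar π = expect (M.trajLaw πref) (M.regReward πref β πstar) -
      expect (M.trajLaw πref) (M.regReward πref β π) := by
  have hint : ∀ p ∈ Pi, Integrable (M.trajLaw πref) (M.regReward πref β p) := fun p hp =>
    integrable_of_abs_le fun τ hτ => hb.abs_regReward_le hr hβ hp hτ
  rw [logGap, ← expect_const_mul, ← expect_sub (hint πstar hstar) (hint π hπ)]
  refine expect_congr fun τ hτ => ?_
  rw [regReward, regReward, hb.logRatio_eq hπ hτ, hb.logRatio_eq hstar hτ]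
  ring

lemma BoundedRatios.expect_logit_sub_rewardGap (hb : M.BoundedRatios πref β Vmax Pi)
    (hr : M.BoundedRewards Rmax) (hβ : 0 < β) (hπ : π ∈ Pi) :
    expect (M.pairLaw πref (M.trajLaw π)) (fun x => M.logit πref β π x - M.rewardGap x) =
      expect (M.trajLaw πref) (M.regReward πref β π) - M.value πref β π := by
  have hint {f : M.Traj × M.Traj → M.Traj}
      (hf : ∀ x ∈ (M.pairLaw πref (M.trajLaw π)).support, f x ∈ (M.trajLaw πref).support) :
      Integrable (M.pairLaw πref (M.trajLaw π)) fun x => M.regReward πref β π (f x) :=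
    integrable_of_abs_le fun x hx => hb.abs_regReward_le hr hβ hπ (hf x hx)
  have hfst := hint fun x hx => (of_mem_support_pairLaw (hb.support_subset hπ) hx).1
  have hsnd := hint fun x hx => (of_mem_support_pairLaw (hb.support_subset hπ) hx).2.1
  have hvalue := expect_map hfst
  have hpref := expect_map hsnd
  rw [map_fst_pairLaw] at hvalue
  rw [map_snd_pairLaw] at hpref
  rw [value, hvalue, hpref, ← expect_sub hsnd hfst]
  refine expect_congr fun x _ => ?_
  rw [logit, rewardGap, regReward, regReward]
  ring

lemma IsOptimal.value_sub_value (hopt : M.IsOptimal πref β πstar) (hr : M.BoundedRewards Rmax)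
    (hb : M.BoundedRatios πref β Vmax Pi) (hβ : 0 < β) (hstar : πstar ∈ Pi) (hπ : π ∈ Pi) :
    M.value πref β πstar - M.value πref β π =
      expect (M.pairLaw πref (M.trajLaw π)) (fun x => M.logit πref β π x - M.rewardGap x) +
        β * M.logGap πref πstar π := by
  rw [hb.expect_logit_sub_rewardGap hr hβ hπ, hb.mul_logGap hr hβ hstar hπ, value,
    hopt.expect_regReward hr hβ (hb.support_subset hstar),
    hopt.expect_regReward hr hβ subset_rfl]
  ring

end DCMDP

/-! ### Exponential moments of one round -/

lemma mul_exp_half_log_sub_log {u v : ℝ} (hu : 0 < u) (hv : 0 < v) :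
    v * Real.exp ((Real.log u - Real.log v) / 2) = √(u * v) := by
  have hsq : (v * Real.exp ((Real.log u - Real.log v) / 2)) ^ 2 = u * v := by
    rw [mul_pow, ← Real.exp_nat_mul, Nat.cast_ofNat, mul_div_cancel₀ _ two_ne_zero, Real.exp_sub,
      Real.exp_log hu, Real.exp_log hv]
    field_simp
  rw [← hsq, Real.sqrt_sq (by positivity)]

lemma lexpect_exp_add_le_one {X : Type*} {p : PMF X} {f : X → ℝ} {a : ℝ}
    (h : lexpect p (fun x => ENNReal.ofReal (Real.exp (f x))) ≤ ENNReal.ofReal (Real.exp (-a))) :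
    lexpect p (fun x => ENNReal.ofReal (Real.exp (f x + a))) ≤ 1 := by
  simp_rw [Real.exp_add, mul_comm _ (Real.exp a), ENNReal.ofReal_mul (Real.exp_pos a).le]
  rw [lexpect_const_mul]
  calc _ ≤ ENNReal.ofReal (Real.exp a) * ENNReal.ofReal (Real.exp (-a)) := by gcongr
    _ = 1 := by
      rw [← ENNReal.ofReal_mul (Real.exp_pos a).le, ← Real.exp_add, add_neg_cancel, Real.exp_zero,
        ENNReal.ofReal_one]

lemma lexpect_exp_half_add_le_one {X : Type*} {p : PMF X} {f g : X → ℝ}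
    (hf : lexpect p (fun x => ENNReal.ofReal (Real.exp (f x))) ≤ 1)
    (hg : lexpect p (fun x => ENNReal.ofReal (Real.exp (g x))) ≤ 1) :
    lexpect p (fun x => ENNReal.ofReal (Real.exp ((f x + g x) / 2))) ≤ 1 := by
  have hconvex : ∀ u v : ℝ, ENNReal.ofReal (Real.exp ((u + v) / 2)) ≤
      (2⁻¹ : ℝ≥0∞) * (ENNReal.ofReal (Real.exp u) + ENNReal.ofReal (Real.exp v)) := fun u v => by
    have h := convexOn_exp.2 (Set.mem_univ u) (Set.mem_univ v)
      (show (0 : ℝ) ≤ 2⁻¹ by norm_num) (show (0 : ℝ) ≤ 2⁻¹ by norm_num) (by norm_num)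
    rw [← ENNReal.ofReal_add (Real.exp_pos _).le (Real.exp_pos _).le, ← ENNReal.ofReal_ofNat 2,
      ← ENNReal.ofReal_inv_of_pos two_pos, ← ENNReal.ofReal_mul (by norm_num), mul_add]
    refine ENNReal.ofReal_le_ofReal (le_of_eq_of_le (congrArg Real.exp ?_) h)
    simp only [smul_eq_mul]
    ring
  calc _ ≤ 2⁻¹ * (lexpect p (fun x => ENNReal.ofReal (Real.exp (f x))) +
        lexpect p (fun x => ENNReal.ofReal (Real.exp (g x)))) := by
        rw [← lexpect_add, ← lexpect_const_mul]
        exact lexpect_mono fun x _ => hconvex _ _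
    _ ≤ 2⁻¹ * (1 + 1) := by gcongr
    _ = 1 := by rw [one_add_one_eq_two, ENNReal.inv_mul_cancel two_ne_zero ENNReal.ofNat_ne_top]

namespace DCMDP

variable {S A : Type*} {M : DCMDP S A} {πref πstar π p : Policy S A} {β Rmax Vmax : ℝ}
  {Pi : Finset (Policy S A)} {x : M.Traj × M.Traj}

lemma bradleyTerry_true (x : M.Traj × M.Traj) :
    M.bradleyTerry x.1 x.2 true = ENNReal.ofReal (Real.sigmoid (M.rewardGap x)) := by
  rw [bradleyTerry, PMF.ofFintype_apply, if_pos rfl, Real.sigmoid_def, rewardGap, neg_sub,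
    Real.exp_sub]
  congr 1
  field_simp

lemma bradleyTerry_false (x : M.Traj × M.Traj) :
    M.bradleyTerry x.1 x.2 false = ENNReal.ofReal (Real.sigmoid (-M.rewardGap x)) := by
  rw [bradleyTerry, PMF.ofFintype_apply, if_neg Bool.false_ne_true, Real.sigmoid_def, rewardGap,
    neg_neg, Real.exp_sub]
  congr 1
  field_simp
  ring

/-- Half of the log-likelihood ratio of the preference models of `π` and `πstar` in one round; the
factor `1 / 2` turns its exponential moment into a Hellinger affinity. -/
def halfLogLikelihood (πref πstar : Policy S A) (β : ℝ) (π : Policy S A) (z : M.Sample) : ℝ :=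
  (Real.log (Real.sigmoid (M.logit πref β π (z.pos, z.neg))) -
    Real.log (Real.sigmoid (M.logit πref β πstar (z.pos, z.neg)))) / 2

variable (M) in
/-- The expected squared Hellinger distance between the preference models of `π` and `πstar` when
`p` and the reference policy generate the responses. -/
def expectHellinger (πref πstar : Policy S A) (β : ℝ) (π p : Policy S A) : ℝ :=
  expect (M.pairLaw πref (M.trajLaw p)) fun x =>
    hellinger (M.logit πref β π x) (M.logit πref β πstar x)

lemma logit_swap (x : M.Traj × M.Traj) :
    M.logit πref β π (x.2, x.1) = -M.logit πref β π x :=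
  (neg_sub _ _).symm

lemma lexpect_bradleyTerry (π : Policy S A) (hx : M.logit πref β πstar x = M.rewardGap x) :
    lexpect ((M.bradleyTerry x.1 x.2).map fun y => (⟨x.1, x.2, y⟩ : M.Sample))
        (fun z => ENNReal.ofReal (Real.exp (halfLogLikelihood πref πstar β π z))) =
      ENNReal.ofReal (1 - hellinger (M.logit πref β π x) (M.logit πref β πstar x)) := by
  rw [lexpect_map, lexpect, tsum_bool, bradleyTerry_true, bradleyTerry_false]
  simp only [halfLogLikelihood, Sample.pos, Sample.neg, if_true, Bool.false_eq_true, if_false,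
    logit_swap]
  rw [← hx, ← ENNReal.ofReal_mul (Real.sigmoid_nonneg _),
    ← ENNReal.ofReal_mul (Real.sigmoid_nonneg _),
    mul_exp_half_log_sub_log (Real.sigmoid_pos _) (Real.sigmoid_pos _),
    mul_exp_half_log_sub_log (Real.sigmoid_pos _) (Real.sigmoid_pos _),
    ← ENNReal.ofReal_add (Real.sqrt_nonneg _) (Real.sqrt_nonneg _), hellinger, sub_sub_cancel,
    add_comm]

lemma integrable_hellinger {X : Type*} {q : PMF X} {f g : X → ℝ} :
    Integrable q fun x => hellinger (f x) (g x) :=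
  integrable_of_abs_le fun _ _ =>
    (abs_of_nonneg (hellinger_nonneg _ _)).trans_le (hellinger_le_one _ _)

lemma IsOptimal.lexpect_exp_halfLogLikelihood_le (hopt : M.IsOptimal πref β πstar)
    (hr : M.BoundedRewards Rmax) (hβ : 0 < β) (π : Policy S A)
    (hp : (M.trajLaw p).support ⊆ (M.trajLaw πref).support) :
    lexpect (M.roundLaw πref p)
        (fun z => ENNReal.ofReal (Real.exp (halfLogLikelihood πref πstar β π z))) ≤
      ENNReal.ofReal (Real.exp (-M.expectHellinger πref πstar β π p)) := by
  rw [roundLaw_eq_bind_pairLaw, lexpect_bind, lexpect_congr fun x hx => by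
    obtain ⟨hfst, hsnd, hinit⟩ := of_mem_support_pairLaw hp hx
    exact lexpect_bradleyTerry π (hopt.logit_eq_rewardGap hr hβ hfst hsnd hinit)]
  rw [← ofReal_expect ((integrable_const _ 1).sub integrable_hellinger)
    fun _ _ => sub_nonneg.2 (hellinger_le_one _ _)]
  refine ENNReal.ofReal_le_ofReal ?_
  rw [expect_sub (integrable_const _ 1) integrable_hellinger, expect_const]
  exact Real.one_sub_le_exp_neg _

lemma lexpect_roundLaw_snd (πref p : Policy S A) (f : M.Traj → ℝ≥0∞) :
    lexpect (M.roundLaw πref p) (fun z => f z.τ') = lexpect (M.trajLaw πref) f := by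
  conv_rhs => rw [← M.map_snd_pairLaw πref p, lexpect_map]
  rw [roundLaw_eq_bind_pairLaw, lexpect_bind]
  exact lexpect_congr fun x _ => (lexpect_map _ _ _).trans (lexpect_const _ (f x.2))

lemma BoundedRatios.lexpect_exp_logGap_le (hb : M.BoundedRatios πref β Vmax Pi)
    (hstar : πstar ∈ Pi) (hπ : π ∈ Pi) (p : Policy S A) (l : ℝ) :
    lexpect (M.roundLaw πref p) (fun z => ENNReal.ofReal (Real.exp (l *
        (Real.log (M.prob π z.τ') - Real.log (M.prob πstar z.τ') - M.logGap πref πstar π)))) ≤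
      ENNReal.ofReal (Real.exp ((2 * Vmax / β) ^ 2 * l ^ 2 / 2)) := by
  rw [lexpect_roundLaw_snd πref p fun τ => ENNReal.ofReal (Real.exp (l *
    (Real.log (M.prob π τ) - Real.log (M.prob πstar τ) - M.logGap πref πstar π)))]
  refine (lexpect_exp_mul_sub_expect_le
    (fun τ hτ => abs_le.1 (hb.abs_log_sub_log_le hstar hπ hτ)) l).trans_eq ?_
  congr 2
  ring

/-- The contribution of a round to the logarithm of the exponential supermartingale: half of the
log-likelihood ratio, minus the optimism term, averaged over the two. -/
def observedTerm (πref πstar : Policy S A) (β α : ℝ) (π : Policy S A) (z : M.Sample) : ℝ :=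
  (halfLogLikelihood πref πstar β π z -
    α / 2 * (Real.log (M.prob π z.τ') - Real.log (M.prob πstar z.τ'))) / 2

variable (M) in
/-- The compensator of `observedTerm` in a round in which `p` is played: with it, the exponential
moment is at most one. -/
def compensator (πref πstar : Policy S A) (β Vmax α : ℝ) (π p : Policy S A) : ℝ :=
  (M.expectHellinger πref πstar β π p + α / 2 * M.logGap πref πstar π -
    (2 * Vmax / β) ^ 2 * (α / 2) ^ 2 / 2) / 2

lemma IsOptimal.lexpect_exp_observedTerm_le_one (hopt : M.IsOptimal πref β πstar)
    (hr : M.BoundedRewards Rmax) (hb : M.BoundedRatios πref β Vmax Pi) (hβ : 0 < β)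
    (hstar : πstar ∈ Pi) (hπ : π ∈ Pi) (hp : (M.trajLaw p).support ⊆ (M.trajLaw πref).support)
    (α : ℝ) :
    lexpect (M.roundLaw πref p) (fun z => ENNReal.ofReal (Real.exp
      (observedTerm πref πstar β α π z + M.compensator πref πstar β Vmax α π p))) ≤ 1 := by
  have hlik := lexpect_exp_add_le_one (hopt.lexpect_exp_halfLogLikelihood_le hr hβ π hp)
  have hgap := hb.lexpect_exp_logGap_le hstar hπ p (-(α / 2))
  rw [← neg_neg ((2 * Vmax / β) ^ 2 * (-(α / 2)) ^ 2 / 2)] at hgap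
  refine le_of_eq_of_le ?_ (lexpect_exp_half_add_le_one hlik (lexpect_exp_add_le_one hgap))
  refine lexpect_congr fun z _ => ?_
  rw [observedTerm, compensator]
  congr 2
  ring

end DCMDP

/-! ### Uniform concentration over the rounds -/

lemma toOuterMeasure_lt_le {X : Type*} {p : PMF X} {f : X → ℝ}
    (h : lexpect p (fun x => ENNReal.ofReal (Real.exp (f x))) ≤ 1) (l : ℝ) :
    p.toOuterMeasure {x | l < f x} ≤ ENNReal.ofReal (Real.exp (-l)) := by
  rw [toOuterMeasure_eq_lexpect]
  calc _ ≤ lexpect p (fun x => ENNReal.ofReal (Real.exp (-l)) *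
        ENNReal.ofReal (Real.exp (f x))) := by
        refine lexpect_mono fun x _ => Set.indicator_apply_le' (fun hx => ?_) fun _ => zero_le
        rw [← ENNReal.ofReal_mul (Real.exp_pos _).le, ← Real.exp_add, Pi.one_apply,
          ENNReal.one_le_ofReal, Real.one_le_exp_iff, neg_add_eq_sub]
        exact sub_nonneg.2 (le_of_lt hx)
    _ ≤ _ := by
        rw [lexpect_const_mul]
        exact mul_le_of_le_one_right' h

lemma one_sub_le_toOuterMeasure {X : Type*} {p : PMF X} {bad good : Set X} {δ : ℝ}
    (hδ : 0 ≤ δ) (hbad : p.toOuterMeasure bad ≤ ENNReal.ofReal δ)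
    (h : ∀ x ∈ p.support, x ∉ bad → x ∈ good) :
    ENNReal.ofReal (1 - δ) ≤ p.toOuterMeasure good := by
  have hcover : p.toOuterMeasure (good ∪ bad) = 1 :=
    (p.toOuterMeasure_apply_eq_one_iff _).2 fun x hx => or_iff_not_imp_right.2 (h x hx)
  have hadd : 1 ≤ p.toOuterMeasure good + ENNReal.ofReal δ :=
    hcover.symm.trans_le ((MeasureTheory.measure_union_le _ _).trans (by gcongr))
  rw [ENNReal.ofReal_sub _ hδ, ENNReal.ofReal_one]
  exact tsub_le_iff_right.2 hadd

namespace DCMDP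

variable {S A : Type*} {M : DCMDP S A} {πref : Policy S A} {upd : List M.Sample → Policy S A}

lemma length_of_mem_support_dataLaw {t : ℕ} {D : List M.Sample}
    (h : D ∈ (dataLaw πref upd t).support) : D.length = t := by
  induction t generalizing D with
  | zero => rw [(PMF.mem_support_pure_iff _ _).1 h, List.length_nil]
  | succ t ih =>
    obtain ⟨D', hD', h⟩ := (PMF.mem_support_bind_iff _ _ _).1 h
    obtain ⟨z, -, rfl⟩ := (PMF.mem_support_map_iff _ _ _).1 h
    rw [List.length_append, ih hD', List.length_singleton]

lemma map_take_dataLaw {t T : ℕ} (h : t ≤ T) :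
    (dataLaw πref upd T).map (List.take t) = dataLaw πref upd t := by
  induction T, h using Nat.le_induction with
  | base =>
    conv_rhs => rw [← PMF.bind_pure (dataLaw πref upd t)]
    rw [← PMF.bind_pure_comp]
    refine bind_congr_support fun D hD => congrArg PMF.pure ?_
    exact List.take_of_length_le (length_of_mem_support_dataLaw hD).le
  | succ T hT ih =>
    rw [← ih, dataLaw, PMF.map_bind, ← PMF.bind_pure_comp]
    refine bind_congr_support fun D hD => ?_
    have htake : List.take t ∘ (fun z => D ++ [z]) = Function.const _ (D.take t) := by
      funext z
      exact List.take_append_of_le_length (hT.trans (length_of_mem_support_dataLaw hD).ge)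
    rw [PMF.map_comp, htake, PMF.map_const, Function.comp_apply]

variable (πref upd) in
/-- The sum of the observed terms `φ` and the compensators `κ` along the data, the logarithm of the
exponential supermartingale. -/
def process (φ : M.Sample → ℝ) (κ : Policy S A → ℝ) (D : List M.Sample) : ℝ :=
  (D.map φ).sum + ∑ j ∈ Finset.range D.length, κ (current πref upd (D.take j))

lemma process_append (φ : M.Sample → ℝ) (κ : Policy S A → ℝ) (D : List M.Sample) (z : M.Sample) :
    process πref upd φ κ (D ++ [z]) =
      process πref upd φ κ D + (φ z + κ (current πref upd D)) := by
  have htake : ∀ j ∈ Finset.range D.length, κ (current πref upd ((D ++ [z]).take j)) =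
      κ (current πref upd (D.take j)) := fun j hj => by
    rw [List.take_append_of_le_length (Finset.mem_range.1 hj).le]
  rw [process, process, List.map_append, List.sum_append, List.length_append,
    List.length_singleton, Finset.sum_range_succ, List.take_left, Finset.sum_congr rfl htake,
    List.map_singleton, List.sum_singleton]
  ring

lemma lexpect_exp_process_le_one {φ : M.Sample → ℝ} {κ : Policy S A → ℝ}
    (h : ∀ D : List M.Sample, lexpect (M.roundLaw πref (current πref upd D))
      (fun z => ENNReal.ofReal (Real.exp (φ z + κ (current πref upd D)))) ≤ 1) (t : ℕ) :
    lexpect (dataLaw πref upd t)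
      (fun D => ENNReal.ofReal (Real.exp (process πref upd φ κ D))) ≤ 1 := by
  induction t with
  | zero => simp [dataLaw, lexpect_pure, process]
  | succ t ih =>
    rw [dataLaw, lexpect_bind]
    refine le_trans (lexpect_mono fun D _ => ?_) ih
    simp_rw [lexpect_map, process_append, Real.exp_add (process πref upd φ κ D),
      ENNReal.ofReal_mul (Real.exp_pos _).le]
    rw [lexpect_const_mul]
    exact mul_le_of_le_one_right' (h D)

lemma toOuterMeasure_exists_lt_process_le {ι : Type*} {I : Finset ι} {φ : ι → M.Sample → ℝ}
    {κ : ι → Policy S A → ℝ}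
    (h : ∀ i ∈ I, ∀ D : List M.Sample, lexpect (M.roundLaw πref (current πref upd D))
      (fun z => ENNReal.ofReal (Real.exp (φ i z + κ i (current πref upd D)))) ≤ 1)
    (l : ℝ) (T : ℕ) :
    (dataLaw πref upd T).toOuterMeasure
        {D | ∃ t ≤ T, t ≠ 0 ∧ ∃ i ∈ I, l < process πref upd (φ i) (κ i) (D.take t)} ≤
      T * (I.card * ENNReal.ofReal (Real.exp (-l))) := by
  have hround : ∀ t ∈ Finset.Icc 1 T, ∀ i ∈ I, (dataLaw πref upd T).toOuterMeasure
      (List.take t ⁻¹' {D | l < process πref upd (φ i) (κ i) D}) ≤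
        ENNReal.ofReal (Real.exp (-l)) := fun t ht i hi => by
    rw [← PMF.toOuterMeasure_map_apply, map_take_dataLaw (Finset.mem_Icc.1 ht).2]
    exact toOuterMeasure_lt_le (lexpect_exp_process_le_one (h i hi) t) l
  calc _ ≤ (dataLaw πref upd T).toOuterMeasure (⋃ t ∈ Finset.Icc 1 T, ⋃ i ∈ I,
        List.take t ⁻¹' {D | l < process πref upd (φ i) (κ i) D}) := by
        refine MeasureTheory.measure_mono ?_
        rintro D ⟨t, htT, ht0, i, hi, hlt⟩
        exact Set.mem_biUnion (Finset.mem_Icc.2 ⟨Nat.one_le_iff_ne_zero.2 ht0, htT⟩)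
          (Set.mem_biUnion hi hlt)
    _ ≤ ∑ t ∈ Finset.Icc 1 T, ∑ i ∈ I, (dataLaw πref upd T).toOuterMeasure
        (List.take t ⁻¹' {D | l < process πref upd (φ i) (κ i) D}) :=
        (MeasureTheory.measure_biUnion_finset_le _ _).trans
          (Finset.sum_le_sum fun t _ => MeasureTheory.measure_biUnion_finset_le _ _)
    _ ≤ ∑ _t ∈ Finset.Icc 1 T, ∑ _i ∈ I, ENNReal.ofReal (Real.exp (-l)) :=
        Finset.sum_le_sum fun t ht => Finset.sum_le_sum (hround t ht)
    _ = T * (I.card * ENNReal.ofReal (Real.exp (-l))) := by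
        simp only [Finset.sum_const, nsmul_eq_mul, Nat.card_Icc, Nat.add_sub_cancel]

end DCMDP

/-! ### Coverability -/

namespace DCMDP

variable {S A : Type*} {M : DCMDP S A} {Pi : Finset (Policy S A)} {π : Policy S A}

lemma trajLaw_le_mul {μ : PMF M.Traj} {K : ℝ≥0∞}
    (hK : ⨆ τ : M.Traj, ⨆ π ∈ Pi, M.trajLaw π τ / μ τ ≤ K) (htop : K ≠ ⊤) (hπ : π ∈ Pi)
    (τ : M.Traj) : M.trajLaw π τ ≤ K * μ τ :=
  (ENNReal.div_le_iff_le_mul (Or.inr htop) (Or.inl (μ.apply_ne_top τ))).1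
    ((iSup₂_le_iff.1 (iSup_le_iff.1 hK τ)) π hπ)

lemma one_le_coverability (hπ : π ∈ Pi) : 1 ≤ M.coverability Pi := by
  refine le_iInf fun μ => ?_
  by_cases htop : ⨆ τ : M.Traj, ⨆ π ∈ Pi, M.trajLaw π τ / μ τ = ⊤
  · exact htop ▸ le_top
  calc (1 : ℝ≥0∞) = ∑' τ, M.trajLaw π τ := (M.trajLaw π).tsum_coe.symm
    _ ≤ ∑' τ, _ * μ τ := ENNReal.tsum_le_tsum (trajLaw_le_mul le_rfl htop hπ)
    _ = _ := by rw [ENNReal.tsum_mul_left, μ.tsum_coe, mul_one]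

lemma coverability_ne_top (hπ : π ∈ Pi) : M.coverability Pi ≠ ⊤ := by
  have hne : Pi.Nonempty := ⟨π, hπ⟩
  have hcard : (Pi.card : ℝ≥0∞) ≠ 0 := Nat.cast_ne_zero.2 hne.card_ne_zero
  refine ne_top_of_le_ne_top (ENNReal.natCast_ne_top Pi.card) ?_
  refine iInf_le_of_le ((PMF.uniformOfFinset Pi hne).bind M.trajLaw) ?_
  refine iSup_le fun τ => iSup₂_le fun p hp => ENNReal.div_le_of_le_mul ?_
  calc M.trajLaw p τ = Pi.card * (PMF.uniformOfFinset Pi hne p * M.trajLaw p τ) := by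
        rw [PMF.uniformOfFinset_apply_of_mem _ hp,
          ENNReal.mul_inv_cancel_left hcard (ENNReal.natCast_ne_top _)]
    _ ≤ _ := by
        gcongr
        rw [PMF.bind_apply]
        exact ENNReal.le_tsum p

lemma one_le_toReal_coverability (hπ : π ∈ Pi) : 1 ≤ (M.coverability Pi).toReal := by
  simpa using ENNReal.toReal_mono (coverability_ne_top hπ) (one_le_coverability (M := M) hπ)

lemma exists_toReal_trajLaw_le (hne : Pi.Nonempty) :
    ∃ μ : PMF M.Traj, ∀ π ∈ Pi, ∀ τ,
      (M.trajLaw π τ).toReal ≤ 2 * (M.coverability Pi).toReal * (μ τ).toReal := by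
  obtain ⟨π₀, hπ₀⟩ := hne
  have htop := coverability_ne_top (M := M) hπ₀
  have htop₂ : 2 * M.coverability Pi ≠ ⊤ := ENNReal.mul_ne_top ENNReal.ofNat_ne_top htop
  have hlt : M.coverability Pi < 2 * M.coverability Pi := by
    rw [two_mul]
    exact ENNReal.lt_add_right htop (one_pos.trans_le (one_le_coverability hπ₀)).ne'
  obtain ⟨μ, hμ⟩ := iInf_lt_iff.1 hlt
  refine ⟨μ, fun π hπ τ => ?_⟩
  have hle := ENNReal.toReal_mono (ENNReal.mul_ne_top htop₂ (μ.apply_ne_top τ))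
    (trajLaw_le_mul hμ.le htop₂ hπ τ)
  rwa [ENNReal.toReal_mul, ENNReal.toReal_mul, ENNReal.toReal_ofNat] at hle

end DCMDP

/-! ### Averaging over the rounds -/

lemma half_le_log {x : ℝ} (hx : 2 ≤ x) : 1 / 2 ≤ Real.log x :=
  calc (1 : ℝ) / 2 ≤ Real.log 2 := by linarith [Real.log_two_gt_d9]
    _ ≤ Real.log x := Real.log_le_log two_pos hx

lemma log_one_add_le_two_mul_log {x : ℝ} (hx : 2 ≤ x) : Real.log (1 + x) ≤ 2 * Real.log x := by
  rw [← Real.log_rpow (by positivity), Real.rpow_two]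
  exact Real.log_le_log (by positivity) (by nlinarith)

lemma sum_inv_succ_le (T : ℕ) : ∑ t ∈ Finset.range T, ((t : ℝ) + 1)⁻¹ ≤ 1 + Real.log T := by
  simpa [harmonic] using harmonic_le_one_add_log T

lemma exists_le_of_le_mul_add_inv {T : ℕ} (hT : 2 ≤ T) {a b K : ℝ} (ha : 0 ≤ a) (hb : 0 ≤ b)
    (hK : 0 ≤ K) {f k : ℕ → ℝ} (hk : ∑ t ∈ Finset.range T, k t ≤ 4 * K * Real.log (1 + T))
    (hf : ∀ t < T, f t ≤ a * k t + b * ((t : ℝ) + 1)⁻¹) :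
    ∃ t < T, f t ≤ (8 * K * a + 3 * b) * (Real.log T / T) := by
  have hT₂ : (2 : ℝ) ≤ T := Nat.ofNat_le_cast.2 hT
  have hlog := half_le_log hT₂
  have hsum : ∑ t ∈ Finset.range T, f t ≤
      ∑ _t ∈ Finset.range T, (8 * K * a + 3 * b) * (Real.log T / T) :=
    calc ∑ t ∈ Finset.range T, f t
        ≤ ∑ t ∈ Finset.range T, (a * k t + b * ((t : ℝ) + 1)⁻¹) :=
          Finset.sum_le_sum fun t ht => hf t (Finset.mem_range.1 ht)
      _ = a * ∑ t ∈ Finset.range T, k t + b * ∑ t ∈ Finset.range T, ((t : ℝ) + 1)⁻¹ := by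
          rw [Finset.sum_add_distrib, Finset.mul_sum, Finset.mul_sum]
      _ ≤ a * (4 * K * (2 * Real.log T)) + b * (3 * Real.log T) := by
          gcongr
          · exact hk.trans (by gcongr; exact log_one_add_le_two_mul_log hT₂)
          · linarith [sum_inv_succ_le T]
      _ = ∑ _t ∈ Finset.range T, (8 * K * a + 3 * b) * (Real.log T / T) := by
          rw [Finset.sum_const, Finset.card_range, nsmul_eq_mul]
          field_simp
          ring
  obtain ⟨t, ht, hle⟩ :=
    Finset.exists_le_of_sum_le (Finset.nonempty_range_iff.2 (by lia)) hsum
  exact ⟨t, Finset.mem_range.1 ht, hle⟩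

lemma sqrt_div_eq_sqrt_mul_div (L : ℝ) {U : ℝ} (hU : 0 < U) : √(L / U) = √(U * L) / U := by
  have hsquare : L / U = U * L / U ^ 2 := by field_simp
  rw [hsquare, Real.sqrt_div' _ (sq_nonneg U), Real.sqrt_sq hU.le]

lemma sqrt_mul_sq_div {K L T l : ℝ} (hT : 0 < T) (hl : 0 ≤ l) :
    √(K * L * l ^ 2 / T) = √(T * K * L) * (l / T) := by
  have hsquare : K * L * l ^ 2 / T = T * K * L * (l / T) ^ 2 := by field_simp
  rw [hsquare, Real.sqrt_mul' _ (sq_nonneg _), Real.sqrt_sq (by positivity)]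

/-- The constant of the regret bound when the optimism parameter is scaled by `c`. -/
def regretConst (c : ℝ) : ℝ := 64 + 1152 * c + 6 * (2 + c ^ 2 / 2) / c

lemma regretConst_pos {c : ℝ} (hc : 0 < c) : 0 < regretConst c := by
  unfold regretConst
  positivity

-- The choice of `α` balances the two terms: the first grows with `α`, the second decays.
lemma averaged_le_regretConst_mul {T c B L K α β : ℝ} (hT : 2 ≤ T) (hc : 0 < c) (hB : 0 < B)
    (hL : 1 / 2 ≤ L) (hK : 0 < K) (hKT : K ≤ T) (hβ : 0 < β)
    (hα : α = c * (β / B) * √(L / (T * K))) :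
    (8 * K * (4 * B + 144 * B ^ 2 * (α * T) / β) + 3 * (2 * β * ((2 + c ^ 2 / 2) * L) / α)) *
      (Real.log T / T) ≤ regretConst c * B * √(K * L * Real.log T ^ 2 / T) := by
  have hlog : 0 ≤ Real.log T := Real.log_nonneg (by linarith)
  rw [sqrt_mul_sq_div (by positivity) hlog, ← mul_assoc (regretConst c * B)]
  rw [sqrt_div_eq_sqrt_mul_div L (by positivity)] at hα
  have hs : 0 < √(T * K * L) := Real.sqrt_pos.2 (by positivity)
  have hsq : √(T * K * L) ^ 2 = T * K * L := Real.sq_sqrt (by positivity)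
  generalize √(T * K * L) = s at *
  have hKs : K ≤ 2 * s := by
    refine le_of_sq_le_sq ?_ (by positivity)
    rw [mul_pow, hsq]
    nlinarith [mul_le_mul_of_nonneg_left hKT hK.le, mul_pos (two_pos.trans_le hT) hK]
  have hestimation : 144 * B ^ 2 * (α * T) / β = 144 * B * c * s / K := by
    rw [hα]
    field_simp
  have hoptimism : 2 * β * ((2 + c ^ 2 / 2) * L) / α = 2 * (2 + c ^ 2 / 2) * B * s / c := by
    have hL : L = s ^ 2 / (T * K) := by
      rw [hsq]
      field_simp
    rw [hα, hL]
    field_simp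
  rw [hestimation, hoptimism]
  gcongr
  calc 8 * K * (4 * B + 144 * B * c * s / K) + 3 * (2 * (2 + c ^ 2 / 2) * B * s / c)
      = 32 * B * K + (1152 * c + 6 * (2 + c ^ 2 / 2) / c) * B * s := by
        field_simp
        ring
    _ ≤ 32 * B * (2 * s) + (1152 * c + 6 * (2 + c ^ 2 / 2) / c) * B * s := by gcongr
    _ = regretConst c * B * s := by
        rw [regretConst]
        ring

lemma four_mul_le_regretConst_mul {T c B L K : ℝ} (hT : 2 ≤ T) (hc : 0 < c) (hB : 0 ≤ B)
    (hL : 1 / 2 ≤ L) (hTK : T ≤ K) :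
    4 * B ≤ regretConst c * B * √(K * L * Real.log T ^ 2 / T) := by
  have hK : 0 < K := by linarith
  have hrate : 1 / 4 ≤ √(K * L * Real.log T ^ 2 / T) := by
    refine Real.le_sqrt_of_sq_le ?_
    rw [le_div_iff₀ (by positivity)]
    calc (1 / 4 : ℝ) ^ 2 * T ≤ T * (1 / 2) * (1 / 2) ^ 2 := by linarith
      _ ≤ K * L * Real.log T ^ 2 := by
        gcongr
        exact half_le_log hT
  have hconst : 64 ≤ regretConst c := by
    rw [regretConst, add_assoc]
    exact le_add_of_nonneg_right (by positivity)
  calc 4 * B ≤ 64 * B * (1 / 4) := by linarith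
    _ ≤ _ := by gcongr

/-! ### The iterates of the algorithm -/

namespace DCMDP

variable {S A : Type*} {M : DCMDP S A} {πref πstar π p : Policy S A} {β Rmax Vmax α L : ℝ}
  {Pi : Finset (Policy S A)} {upd : List M.Sample → Policy S A} {D : List M.Sample} {T : ℕ}

lemma IsUpdate.current_mem (hupd : M.IsUpdate πref β α Pi upd) (hD : D ≠ []) :
    current πref upd D ∈ Pi := by
  cases D with
  | nil => exact absurd rfl hD
  | cons z D => exact (hupd _ hD).1

lemma IsUpdate.objective_current_le (hupd : M.IsUpdate πref β α Pi upd) (hD : D ≠ [])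
    (hπ : π ∈ Pi) : M.objective πref β α D (current πref upd D) ≤ M.objective πref β α D π := by
  cases D with
  | nil => exact absurd rfl hD
  | cons z D => exact (hupd _ hD).2 π hπ

lemma IsUpdate.support_subset (hupd : M.IsUpdate πref β α Pi upd)
    (hb : M.BoundedRatios πref β Vmax Pi) (D : List M.Sample) :
    (M.trajLaw (current πref upd D)).support ⊆ (M.trajLaw πref).support := by
  cases D with
  | nil => exact subset_rfl
  | cons z D => exact hb.support_subset (hupd.current_mem (List.cons_ne_nil z D))

lemma sum_observedTerm (π : Policy S A) (D : List M.Sample) :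
    (D.map (observedTerm πref πstar β α π)).sum =
      (M.objective πref β α D πstar - M.objective πref β α D π) / 4 := by
  induction D with
  | nil => simp [objective]
  | cons z D ih =>
    rw [List.map_cons, List.sum_cons, ih]
    simp only [objective, List.map_cons, List.sum_cons, observedTerm, halfLogLikelihood, logit]
    ring

lemma sum_compensator (π : Policy S A) (p : ℕ → Policy S A) (n : ℕ) :
    ∑ j ∈ Finset.range n, M.compensator πref πstar β Vmax α π (p j) =
      (∑ j ∈ Finset.range n, M.expectHellinger πref πstar β π (p j) +
        n * (α / 2 * M.logGap πref πstar π - (2 * Vmax / β) ^ 2 * (α / 2) ^ 2 / 2)) / 2 := by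
  simp only [compensator, add_sub_assoc]
  rw [← Finset.sum_div, Finset.sum_add_distrib, Finset.sum_const, Finset.card_range,
    nsmul_eq_mul]

lemma IsUpdate.sum_expectHellinger_le (hupd : M.IsUpdate πref β α Pi upd) (hstar : πstar ∈ Pi)
    (hD : D ≠ [])
    (hL : process πref upd (observedTerm πref πstar β α (current πref upd D))
      (M.compensator πref πstar β Vmax α (current πref upd D)) D ≤ L) :
    ∑ j ∈ Finset.range D.length, M.expectHellinger πref πstar β (current πref upd D)
        (current πref upd (D.take j)) +
      D.length * (α / 2 * M.logGap πref πstar (current πref upd D)) ≤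
      2 * L + D.length * ((2 * Vmax / β) ^ 2 * (α / 2) ^ 2 / 2) := by
  rw [process, sum_observedTerm, sum_compensator] at hL
  linarith [hupd.objective_current_le hD hstar]

/-- The factor by which rewards and log-ratios of the given ranges inflate the error of the implicit
reward relative to the Hellinger distance of the preference models. -/
def rangeFactor (Rmax Vmax : ℝ) : ℝ := (Vmax + Rmax) * Real.exp (2 * Rmax)

lemma add_le_rangeFactor (hR : 0 ≤ Rmax) (hV : 0 ≤ Vmax) : Vmax + Rmax ≤ rangeFactor Rmax Vmax :=
  le_mul_of_one_le_right (add_nonneg hV hR) (Real.one_le_exp (by positivity))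

lemma one_add_mul_exp_le_rangeFactor (hR : 0 ≤ Rmax) (hVR : 1 ≤ Vmax + Rmax) :
    (1 + (2 * Vmax + Rmax)) * Real.exp Rmax ≤ 3 * rangeFactor Rmax Vmax :=
  calc _ ≤ 3 * (Vmax + Rmax) * Real.exp (2 * Rmax) := by
        gcongr <;> linarith
    _ = _ := mul_assoc _ _ _

lemma BoundedRatios.abs_le_of_mem_support_pairLaw (hb : M.BoundedRatios πref β Vmax Pi)
    (hr : M.BoundedRewards Rmax) (hβ : 0 < β) (hπ : π ∈ Pi)
    (hp : (M.trajLaw p).support ⊆ (M.trajLaw πref).support) {x : M.Traj × M.Traj}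
    (hx : x ∈ (M.pairLaw πref (M.trajLaw p)).support) :
    |M.logit πref β π x - M.rewardGap x| ≤ 2 * Vmax + Rmax :=
  have ⟨hfst, hsnd, _⟩ := of_mem_support_pairLaw hp hx
  hb.abs_logit_sub_rewardGap_le hr hβ hπ hfst hsnd

lemma BoundedRatios.integrable_sq (hb : M.BoundedRatios πref β Vmax Pi)
    (hr : M.BoundedRewards Rmax) (hβ : 0 < β) (hπ : π ∈ Pi)
    (hp : (M.trajLaw p).support ⊆ (M.trajLaw πref).support) :
    Integrable (M.pairLaw πref (M.trajLaw p))
      fun x => (M.logit πref β π x - M.rewardGap x) ^ 2 :=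
  integrable_of_abs_le (B := (2 * Vmax + Rmax) ^ 2) fun x hx => by
    rw [abs_pow]
    exact pow_le_pow_left₀ (abs_nonneg _) (hb.abs_le_of_mem_support_pairLaw hr hβ hπ hp hx) 2

lemma IsOptimal.expect_sq_le_expectHellinger (hopt : M.IsOptimal πref β πstar)
    (hr : M.BoundedRewards Rmax) (hb : M.BoundedRatios πref β Vmax Pi) (hβ : 0 < β)
    (hR : 0 ≤ Rmax) (hVR : 1 ≤ Vmax + Rmax) (hπ : π ∈ Pi)
    (hp : (M.trajLaw p).support ⊆ (M.trajLaw πref).support) :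
    expect (M.pairLaw πref (M.trajLaw p)) (fun x => (M.logit πref β π x - M.rewardGap x) ^ 2) ≤
      576 * rangeFactor Rmax Vmax ^ 2 * M.expectHellinger πref πstar β π p := by
  have hle : ∀ x ∈ (M.pairLaw πref (M.trajLaw p)).support,
      (M.logit πref β π x - M.rewardGap x) ^ 2 ≤ 576 * rangeFactor Rmax Vmax ^ 2 *
        hellinger (M.logit πref β π x) (M.logit πref β πstar x) := fun x hx => by
    obtain ⟨hfst, hsnd, hinit⟩ := of_mem_support_pairLaw hp hx
    rw [hopt.logit_eq_rewardGap hr hβ hfst hsnd hinit]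
    have hhell := hellinger_nonneg (M.logit πref β π x) (M.rewardGap x)
    calc _ ≤ 64 * ((1 + (2 * Vmax + Rmax)) * Real.exp Rmax) ^ 2 *
          hellinger (M.logit πref β π x) (M.rewardGap x) :=
          sq_sub_le_hellinger (hr.abs_rewardGap_le hfst hsnd)
            (hb.abs_logit_sub_rewardGap_le hr hβ hπ hfst hsnd)
      _ ≤ 64 * (3 * rangeFactor Rmax Vmax) ^ 2 *
          hellinger (M.logit πref β π x) (M.rewardGap x) := by
          have hV := hb.Vmax_nonneg hβ hπ
          gcongr 64 * ?_ ^ 2 * _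
          exact one_add_mul_exp_le_rangeFactor hR hVR
      _ = _ := by ring
  have hint := integrable_hellinger (q := M.pairLaw πref (M.trajLaw p))
    (f := M.logit πref β π) (g := M.logit πref β πstar)
  rw [expectHellinger, ← expect_const_mul]
  exact expect_mono (hb.integrable_sq hr hβ hπ hp) (hint.const_mul _) hle

/-! ### The regret of an iterate -/

lemma toReal_pairLaw_le {q μ : PMF M.Traj} {C : ℝ}
    (h : ∀ τ, (q τ).toReal ≤ C * (μ τ).toReal) (x : M.Traj × M.Traj) :
    (M.pairLaw πref q x).toReal ≤ C * (M.pairLaw πref μ x).toReal := by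
  rw [pairLaw_apply, pairLaw_apply, ENNReal.toReal_mul, ENNReal.toReal_mul, ← mul_assoc]
  exact mul_le_mul_of_nonneg_right (h x.1) ENNReal.toReal_nonneg

lemma IsOptimal.value_sub_value_le (hopt : M.IsOptimal πref β πstar)
    (hr : M.BoundedRewards Rmax) (hb : M.BoundedRatios πref β Vmax Pi) (hβ : 0 < β)
    (hstar : πstar ∈ Pi) (hπ : π ∈ Pi) :
    M.value πref β πstar - M.value πref β π ≤ 4 * Vmax + Rmax := by
  have herror : |expect (M.pairLaw πref (M.trajLaw π))
      fun x => M.logit πref β π x - M.rewardGap x| ≤ 2 * Vmax + Rmax :=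
    abs_expect_le fun x hx =>
      hb.abs_le_of_mem_support_pairLaw hr hβ hπ (hb.support_subset hπ) hx
  have hgap : |M.logGap πref πstar π| ≤ 2 * Vmax / β :=
    abs_expect_le fun τ hτ => hb.abs_log_sub_log_le hstar hπ hτ
  have hmul : β * M.logGap πref πstar π ≤ 2 * Vmax :=
    (le_div_iff₀' hβ).1 ((le_abs_self _).trans hgap)
  rw [hopt.value_sub_value hr hb hβ hstar hπ]
  linarith [le_abs_self (expect (M.pairLaw πref (M.trajLaw π))
    fun x => M.logit πref β π x - M.rewardGap x)]

lemma IsOptimal.expect_logit_sub_rewardGap_le (hopt : M.IsOptimal πref β πstar)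
    (hr : M.BoundedRewards Rmax) (hb : M.BoundedRatios πref β Vmax Pi) (hβ : 0 < β)
    (hR : 0 ≤ Rmax) (hVR : 1 ≤ Vmax + Rmax) {p : ℕ → Policy S A} (hp : ∀ i, p i ∈ Pi)
    {μ : PMF M.Traj} {C η : ℝ} {t : ℕ}
    (hμ : ∀ τ, (M.trajLaw (p t) τ).toReal ≤ C * (μ τ).toReal) (hη : 0 < η) :
    expect (M.pairLaw πref (M.trajLaw (p t)))
        (fun x => M.logit πref β (p t) x - M.rewardGap x) ≤
      (2 * (2 * Vmax + Rmax) + 1 / η) *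
        ∑' x, novelty (fun i => M.pairLaw πref (M.trajLaw (p i))) (M.pairLaw πref μ) C t x +
      η / 2 * ∑ i ∈ Finset.range t, 576 * rangeFactor Rmax Vmax ^ 2 *
        M.expectHellinger πref πstar β (p t) (p i) := by
  have hsupp := fun i => hb.support_subset (hp i)
  have hG : ∀ x ∈ (M.pairLaw πref (M.trajLaw (p t))).support,
      |M.logit πref β (p t) x - M.rewardGap x| ≤ 2 * Vmax + Rmax := fun x hx =>
    hb.abs_le_of_mem_support_pairLaw hr hβ (hp t) (hsupp t) hx
  calc _ ≤ expect (M.pairLaw πref (M.trajLaw (p t)))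
          (fun x => |M.logit πref β (p t) x - M.rewardGap x|) :=
        expect_mono (integrable_of_abs_le hG)
          (integrable_of_abs_le fun x hx => (abs_abs _).trans_le (hG x hx))
          fun x _ => le_abs_self _
    _ ≤ _ := expect_abs_le_novelty (p := fun i => M.pairLaw πref (M.trajLaw (p i)))
        (toReal_pairLaw_le hμ) hη hG fun i _ => hb.integrable_sq hr hβ (hp t) (hsupp i)
    _ ≤ _ := by
        gcongr with i
        exact hopt.expect_sq_le_expectHellinger hr hb hβ hR hVR (hp t) (hsupp i)

lemma IsOptimal.value_sub_value_le_novelty (hopt : M.IsOptimal πref β πstar)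
    (hr : M.BoundedRewards Rmax) (hb : M.BoundedRatios πref β Vmax Pi) (hβ : 0 < β)
    (hR : 0 ≤ Rmax) (hVR : 1 ≤ Vmax + Rmax) (hstar : πstar ∈ Pi) {p : ℕ → Policy S A}
    (hp : ∀ i, p i ∈ Pi) {μ : PMF M.Traj} {C l : ℝ} {t : ℕ}
    (hμ : ∀ τ, (M.trajLaw (p t) τ).toReal ≤ C * (μ τ).toReal) (hl : 0 < l)
    (hL : ∑ i ∈ Finset.range t, M.expectHellinger πref πstar β (p t) (p i) +
      β / l * M.logGap πref πstar (p t) ≤ L) :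
    M.value πref β πstar - M.value πref β (p t) ≤
      (4 * rangeFactor Rmax Vmax + 288 * rangeFactor Rmax Vmax ^ 2 / l) *
        ∑' x, novelty (fun i => M.pairLaw πref (M.trajLaw (p i))) (M.pairLaw πref μ) C t x +
      l * L := by
  have hV := hb.Vmax_nonneg hβ hstar
  have hVB := add_le_rangeFactor hR hV
  have herror := fun η hη => hopt.expect_logit_sub_rewardGap_le (η := η) hr hb hβ hR hVR hp hμ hη
  generalize rangeFactor Rmax Vmax = B at *
  have hB : 0 < B := by linarith
  have hN := tsum_novelty_nonneg (p := fun i => M.pairLaw πref (M.trajLaw (p i)))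
    (toReal_pairLaw_le (πref := πref) hμ)
  rw [hopt.value_sub_value hr hb hβ hstar (hp t)]
  -- For this `η` the optimism term of `hL` absorbs the term `β * logGap` of the regret.
  refine (add_le_add_left (herror (l / (288 * B ^ 2)) (by positivity)) _).trans ?_
  generalize ∑' x, novelty _ _ C t x = N at *
  calc _ = (2 * (2 * Vmax + Rmax) + 288 * B ^ 2 / l) * N + l *
          (∑ i ∈ Finset.range t, M.expectHellinger πref πstar β (p t) (p i) +
            β / l * M.logGap πref πstar (p t)) := by
        rw [← Finset.mul_sum]
        field_simp
        ring
    _ ≤ _ := by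
        gcongr (?_ + _) * _ + _ * ?_
        linarith

lemma IsOptimal.value_sub_value_le_novelty_add_inv (hopt : M.IsOptimal πref β πstar)
    (hr : M.BoundedRewards Rmax) (hb : M.BoundedRatios πref β Vmax Pi) (hβ : 0 < β)
    (hR : 0 ≤ Rmax) (hVR : 1 ≤ Vmax + Rmax) (hstar : πstar ∈ Pi) {p : ℕ → Policy S A}
    (hp : ∀ i, p i ∈ Pi) {μ : PMF M.Traj} {C : ℝ} {t : ℕ}
    (hμ : ∀ τ, (M.trajLaw (p t) τ).toReal ≤ C * (μ τ).toReal) (hα : 0 < α) (ht : t < T)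
    (hL : ∑ i ∈ Finset.range t, M.expectHellinger πref πstar β (p t) (p i) +
      ((t : ℝ) + 1) * (α / 2 * M.logGap πref πstar (p t)) ≤ L) :
    M.value πref β πstar - M.value πref β (p t) ≤
      (4 * rangeFactor Rmax Vmax + 144 * rangeFactor Rmax Vmax ^ 2 * (α * T) / β) *
        ∑' x, novelty (fun i => M.pairLaw πref (M.trajLaw (p i))) (M.pairLaw πref μ) C t x +
      2 * β * L / α * ((t : ℝ) + 1)⁻¹ := by
  have htT : (t : ℝ) + 1 ≤ T := by exact_mod_cast ht
  have hN := tsum_novelty_nonneg (p := fun i => M.pairLaw πref (M.trajLaw (p i)))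
    (toReal_pairLaw_le (πref := πref) hμ)
  have hscale : β / (2 * β / (α * (t + 1))) * M.logGap πref πstar (p t) =
      (t + 1) * (α / 2 * M.logGap πref πstar (p t)) := by field_simp
  have hle := hopt.value_sub_value_le_novelty hr hb hβ hR hVR hstar hp hμ
    (l := 2 * β / (α * (t + 1))) (by positivity) (hscale ▸ hL)
  generalize ∑' x, novelty _ _ C t x = N at *
  calc _ ≤ _ := hle
    _ = (4 * rangeFactor Rmax Vmax + 144 * rangeFactor Rmax Vmax ^ 2 * (α * (t + 1)) / β) * N +
        2 * β * L / α * ((t : ℝ) + 1)⁻¹ := by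
        field_simp
        ring
    _ ≤ _ := by gcongr

/-! ### The best iterate -/

lemma mul_sq_optimism_le {c n B K V : ℝ} (hB : 0 < B) (hL : 0 ≤ L) (hK : 1 ≤ K) (hn : 0 ≤ n)
    (hnT : n ≤ T) (hβ : 0 < β) (hV : 0 ≤ V) (hVB : V ≤ B)
    (hα : α = c * (β / B) * √(L / (T * K))) :
    n * ((2 * V / β) ^ 2 * (α / 2) ^ 2 / 2) ≤ c ^ 2 / 2 * L := by
  rcases hn.eq_or_lt with rfl | hn
  · rw [zero_mul]
    positivity
  have hT : (0 : ℝ) < T := hn.trans_le hnT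
  have heq : (2 * V / β) ^ 2 * (α / 2) ^ 2 / 2 = (V / B) ^ 2 * (c ^ 2 / 2 * L / T) / K := by
    rw [hα, div_pow (c * (β / B) * √(L / (T * K))), mul_pow, Real.sq_sqrt (by positivity)]
    field_simp
  calc n * ((2 * V / β) ^ 2 * (α / 2) ^ 2 / 2)
      ≤ T * (1 ^ 2 * (c ^ 2 / 2 * L / T) / 1) := by
        rw [heq]
        gcongr
        exact (div_le_one hB).2 hVB
    _ = c ^ 2 / 2 * L := by field_simp

lemma IsUpdate.sum_expectHellinger_take_le (hupd : M.IsUpdate πref β α Pi upd)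
    (hstar : πstar ∈ Pi) {p : ℕ → Policy S A} (hp : ∀ i, p i = current πref upd (D.take (i + 1)))
    {t : ℕ} (ht : t < D.length)
    (hL : process πref upd (observedTerm πref πstar β α (p t))
      (M.compensator πref πstar β Vmax α (p t)) (D.take (t + 1)) ≤ L) :
    ∑ i ∈ Finset.range t, M.expectHellinger πref πstar β (p t) (p i) +
      ((t : ℝ) + 1) * (α / 2 * M.logGap πref πstar (p t)) ≤
      2 * L + ((t : ℝ) + 1) * ((2 * Vmax / β) ^ 2 * (α / 2) ^ 2 / 2) := by
  have hlen : (D.take (t + 1)).length = t + 1 := List.length_take_of_le ht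
  rw [hp t] at hL
  have hsum := hupd.sum_expectHellinger_le hstar
    (List.ne_nil_of_length_eq_add_one hlen) hL
  have htake : ∀ i ∈ Finset.range t, (D.take (t + 1)).take (i + 1) = D.take (i + 1) :=
    fun i hi => by
      rw [List.take_take, min_eq_left (Nat.succ_le_succ (Finset.mem_range.1 hi).le)]
  rw [hlen, Finset.sum_range_succ', ← hp t, Nat.cast_add_one,
    Finset.sum_congr rfl fun i hi => by rw [htake i hi, ← hp i]] at hsum
  have hfirst : 0 ≤ M.expectHellinger πref πstar β (p t)
      (current πref upd ((D.take (t + 1)).take 0)) :=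
    expect_nonneg fun x _ => hellinger_nonneg _ _
  linarith

lemma IsUpdate.exists_value_sub_value_le_of_coverability_le (hupd : M.IsUpdate πref β α Pi upd)
    (hopt : M.IsOptimal πref β πstar) (hr : M.BoundedRewards Rmax)
    (hb : M.BoundedRatios πref β Vmax Pi) (hβ : 0 < β) (hR : 0 ≤ Rmax) (hVR : 1 ≤ Vmax + Rmax)
    (hstar : πstar ∈ Pi) {c : ℝ} (hc : 0 < c) (hT : 2 ≤ T) (hL : 1 / 2 ≤ L)
    (hKT : (M.coverability Pi).toReal ≤ T)
    (hα : α = c * (β / rangeFactor Rmax Vmax) * √(L / (T * (M.coverability Pi).toReal)))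
    (hlen : D.length = T) (hD : ∀ t ≤ T, t ≠ 0 → ∀ π ∈ Pi,
      process πref upd (observedTerm πref πstar β α π)
        (M.compensator πref πstar β Vmax α π) (D.take t) ≤ L)
    {p : ℕ → Policy S A} (hp : ∀ i, p i = current πref upd (D.take (i + 1)))
    (hmem : ∀ i, p i ∈ Pi) :
    ∃ t < T, M.value πref β πstar - M.value πref β (p t) ≤
      regretConst c * rangeFactor Rmax Vmax *
        √((M.coverability Pi).toReal * L * Real.log T ^ 2 / T) := by
  have hV := hb.Vmax_nonneg hβ hstar
  have hVB := add_le_rangeFactor hR hV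
  have hB : 0 < rangeFactor Rmax Vmax := by linarith
  have hK := one_le_toReal_coverability (M := M) hstar
  have hT₂ : (2 : ℝ) ≤ T := Nat.ofNat_le_cast.2 hT
  have hrate : 0 < √(L / (T * (M.coverability Pi).toReal)) := Real.sqrt_pos.2 (by positivity)
  have hα₀ : 0 < α := hα ▸ mul_pos (by positivity) hrate
  obtain ⟨μ, hμ⟩ := exists_toReal_trajLaw_le (M := M) ⟨πstar, hstar⟩
  have hpotential := sum_tsum_novelty_le
    (fun i => toReal_pairLaw_le (πref := πref) (hμ _ (hmem i))) T
  have hfit : ∀ t < T, ∑ i ∈ Finset.range t, M.expectHellinger πref πstar β (p t) (p i) +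
      ((t : ℝ) + 1) * (α / 2 * M.logGap πref πstar (p t)) ≤ (2 + c ^ 2 / 2) * L := fun t ht => by
    have hsum := hupd.sum_expectHellinger_take_le hstar hp (hlen ▸ ht)
      (hD (t + 1) ht t.succ_ne_zero _ (hmem t))
    have hoptimism := mul_sq_optimism_le hB (by linarith) hK (by positivity : (0 : ℝ) ≤ t + 1)
      (by exact_mod_cast ht) hβ hV (by linarith) hα
    linarith
  obtain ⟨t, ht, hle⟩ := exists_le_of_le_mul_add_inv hT (by positivity) (by positivity)
    (by positivity) (hpotential.trans_eq (by ring : _ = 4 * (M.coverability Pi).toReal * _))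
    fun t ht => hopt.value_sub_value_le_novelty_add_inv hr hb hβ hR hVR hstar hmem
      (hμ _ (hmem t)) hα₀ ht (hfit t ht)
  exact ⟨t, ht, hle.trans (averaged_le_regretConst_mul hT₂ hc hB hL (by positivity) hKT hβ hα)⟩

lemma IsUpdate.exists_value_sub_value_le (hupd : M.IsUpdate πref β α Pi upd)
    (hopt : M.IsOptimal πref β πstar) (hr : M.BoundedRewards Rmax)
    (hb : M.BoundedRatios πref β Vmax Pi) (hβ : 0 < β) (hR : 0 ≤ Rmax) (hVR : 1 ≤ Vmax + Rmax)
    (hstar : πstar ∈ Pi) {c : ℝ} (hc : 0 < c) (hT : 2 ≤ T) (hL : 1 / 2 ≤ L)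
    (hα : α = c * (β / rangeFactor Rmax Vmax) * √(L / (T * (M.coverability Pi).toReal)))
    (hlen : D.length = T) (hD : ∀ t ≤ T, t ≠ 0 → ∀ π ∈ Pi,
      process πref upd (observedTerm πref πstar β α π)
        (M.compensator πref πstar β Vmax α π) (D.take t) ≤ L) :
    ∃ t ≤ T, current πref upd (D.take t) ∈ Pi ∧
      M.value πref β πstar - M.value πref β (current πref upd (D.take t)) ≤
        regretConst c * rangeFactor Rmax Vmax *
          √((M.coverability Pi).toReal * L * Real.log T ^ 2 / T) := by
  have hmem : ∀ i, current πref upd (D.take (i + 1)) ∈ Pi := fun i =>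
    hupd.current_mem (List.ne_nil_of_length_pos (by rw [List.length_take, hlen]; lia))
  rcases le_total (M.coverability Pi).toReal T with hKT | hTK
  · obtain ⟨t, ht, hle⟩ := hupd.exists_value_sub_value_le_of_coverability_le hopt hr hb hβ hR hVR
      hstar hc hT hL hKT hα hlen hD (fun _ => rfl) hmem
    exact ⟨t + 1, ht, hmem t, hle⟩
  · have hVB := add_le_rangeFactor hR (hb.Vmax_nonneg hβ hstar)
    have hle := hopt.value_sub_value_le hr hb hβ hstar (hmem 0)
    have hrate := four_mul_le_regretConst_mul (Nat.ofNat_le_cast.2 hT) hc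
      (by linarith : 0 ≤ rangeFactor Rmax Vmax) hL hTK
    exact ⟨1, by lia, hmem 0, by linarith⟩

/-! ### The failure event -/

lemma half_le_log_mul_div {n δ : ℝ} (hn : 1 ≤ n) {T : ℝ} (hT : 2 ≤ T) (hδ : 0 < δ) (hδ₁ : δ ≤ 1) :
    1 / 2 ≤ Real.log (n * T / δ) := by
  refine half_le_log ((le_div_iff₀ hδ).2 ?_)
  nlinarith

lemma IsUpdate.toOuterMeasure_exists_lt_process_le (hupd : M.IsUpdate πref β α Pi upd)
    (hopt : M.IsOptimal πref β πstar) (hr : M.BoundedRewards Rmax)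
    (hb : M.BoundedRatios πref β Vmax Pi) (hβ : 0 < β) (hstar : πstar ∈ Pi) (hT : 0 < T)
    {δ : ℝ} (hδ : 0 < δ) :
    (dataLaw πref upd T).toOuterMeasure {D | ∃ t ≤ T, t ≠ 0 ∧ ∃ π ∈ Pi,
      Real.log (Pi.card * T / δ) < process πref upd (observedTerm πref πstar β α π)
        (M.compensator πref πstar β Vmax α π) (D.take t)} ≤ ENNReal.ofReal δ := by
  have hcard : (0 : ℝ) < Pi.card := Nat.cast_pos.2 (Finset.card_pos.2 ⟨πstar, hstar⟩)
  have hT₀ : (0 : ℝ) < T := Nat.cast_pos.2 hT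
  refine (DCMDP.toOuterMeasure_exists_lt_process_le (fun π hπ D =>
    hopt.lexpect_exp_observedTerm_le_one hr hb hβ hstar hπ (hupd.support_subset hb D) α)
    _ T).trans_eq ?_
  rw [Real.exp_neg, Real.exp_log (div_pos (mul_pos hcard hT₀) hδ),
    ← ENNReal.ofReal_natCast T, ← ENNReal.ofReal_natCast Pi.card,
    ← ENNReal.ofReal_mul (Nat.cast_nonneg _), ← ENNReal.ofReal_mul (Nat.cast_nonneg _)]
  congr 1
  field_simp

end DCMDP

end XPO

end

theorem theorem1 (c : ℝ) (hc : 0 < c) :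
    ∃ C : ℝ, 0 < C ∧
      ∀ (S A : Type*) (M : XPO.DCMDP S A) (πref : XPO.Policy S A)
        (Pi : Finset (XPO.Policy S A)) (πstar : XPO.Policy S A)
        (β Rmax Vmax δ : ℝ) (T : ℕ) (α : ℝ) (upd : List M.Sample → XPO.Policy S A),
        0 < β → 0 < Rmax → 1 ≤ Vmax + Rmax → 0 < δ → δ < 1 → 2 ≤ T →
        (∀ τ : M.Traj, M.Admissible τ → 0 ≤ M.reward τ ∧ M.reward τ ≤ Rmax) →
        M.IsOptimal πref β πstar →
        πstar ∈ Pi →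
        M.BoundedRatios πref β Vmax Pi →
        α = c * (β / ((Vmax + Rmax) * Real.exp (2 * Rmax))) *
          Real.sqrt (Real.log (Pi.card * T / δ) / (T * (M.coverability Pi).toReal)) →
        M.IsUpdate πref β α Pi upd →
        ENNReal.ofReal (1 - δ) ≤
          (XPO.DCMDP.dataLaw πref upd T).toOuterMeasure
            {D | ∀ πhat : XPO.Policy S A, XPO.DCMDP.IsOutput πref β upd T D πhat →
              M.J πref β πstar - M.J πref β πhat ≤
                ((C * ((Vmax + Rmax) * Real.exp (2 * Rmax)) *
                  Real.sqrt ((M.coverability Pi).toReal * Real.log (Pi.card * T / δ) *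
                    Real.log T ^ 2 / T) : ℝ) : EReal)} := by
  refine ⟨XPO.regretConst c, XPO.regretConst_pos hc, ?_⟩
  intro S A M πref Pi πstar β Rmax Vmax δ T α upd hβ hR hVR hδ hδ₁ hT hr hopt hstar hb hα hupd
  have hcard : (1 : ℝ) ≤ Pi.card := Nat.one_le_cast.2 (Finset.card_pos.2 ⟨πstar, hstar⟩)
  have hL := XPO.DCMDP.half_le_log_mul_div hcard (Nat.ofNat_le_cast.2 hT) hδ hδ₁.le
  have hfail := hupd.toOuterMeasure_exists_lt_process_le hopt hr hb hβ hstar (by lia : 0 < T) hδ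
  refine XPO.one_sub_le_toOuterMeasure hδ.le hfail fun D hD hgood πhat hhat => ?_
  rw [Set.mem_ofPred_eq] at hgood
  push Not at hgood
  obtain ⟨t, ht, hmem, hle⟩ := hupd.exists_value_sub_value_le hopt hr hb hβ hR.le hVR hstar hc hT
    hL hα (XPO.DCMDP.length_of_mem_support_dataLaw hD) hgood
  calc M.J πref β πstar - M.J πref β πhat
      ≤ M.J πref β πstar - M.J πref β (XPO.DCMDP.current πref upd (D.take t)) :=
        EReal.sub_le_sub le_rfl (hhat.2 t ht)
    _ = ((M.value πref β πstar -
          M.value πref β (XPO.DCMDP.current πref upd (D.take t)) : ℝ) : EReal) := by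
        rw [hb.J_eq_value hstar, hb.J_eq_value hmem, EReal.coe_sub]
    _ ≤ _ := EReal.coe_le_coe hle
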